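/- Let $a<b$ be real, $0<\lambda<1$, $\beta>0$ and $0<d<\pi$. Put $\varphi_{a,b}(x)=\frac{b-a}{2}\tanh\frac{x}{2}+\frac{b+a}{2}$ and let $$\mathcal D=\varphi_{a,b}(\{x\in\mathbb C:|\operatorname{Im}x|<d\})=\Big\{z\in\mathbb C\setminus\{a,b\}:\Big|\arg\frac{z-a}{b-z}\Big|<d\Big\},$$ a bounded simply connected domain containing $(a,b)$. Let $\mathbf H^\infty(\mathcal D)$ be the set of bounded analytic functions on $\mathcal D$. For $\alpha>0$ let $\mathcal L_\alpha(\mathcal D)$ be the set of $f\in\mathbf H^\infty(\mathcal D)$ for which there is $C>0$ with $|f(z)|\le C|(z-a)(b-z)|^\alpha$ for all $z\in\mathcal D$, and let $\mathcal M_\alpha(\mathcal D)$ be the set of functions $f$, analytic on $\mathcal D$ and continuous on $\overline{\mathcal D}$, such that $$G[f](z)=f(z)-\Big[\frac{b-z}{b-a}f(a)+\frac{z-a}{b-a}f(b)\Big]$$ belongs to $\mathcal L_\alpha(\mathcal D)$. Let $k:\overline{\mathcal D}^3\to\mathbb C$ be a bounded function such that - $k(z,\cdot,w)\in\mathbf H^\infty(\mathcal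 D)$ for all $z,w\in\overline{\mathcal D}$, and $k(z,v,\cdot)\in\mathbf H^\infty(\mathcal D)$ for all $z,v\in\overline{\mathcal D}$; - $k(\cdot,v,w)\in\mathcal M_{1-\lambda}(\mathcal D)$ for all $v,w\in\overline{\mathcal D}$, where the constant in the bound $|G[k(\cdot,v,w)](z)|\le C|(z-a)(b-z)|^{1-\lambda}$ can be chosen independently of $v$ and $w$. Let $g\in\mathcal M_\beta(\mathcal D)$. Let $u\in\mathbf H^\infty(\mathcal D)\cap C(\overline{\mathcal D})$ with $u(\overline{\mathcal D})\subseteq\overline{\mathcal D}$ be a solution of the weakly singular Urysohn equation $$u(t)=g(t)+\int_a^b|t-s|^{-\lambda}\,k(t,s,u(s))\,\mathrm ds,\qquad t\in[a,b].$$ Then $u\in\mathcal M_\gamma(\mathcal D)$ with $\gamma=\min(1-\lambda,\beta)$. -/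

import Mathlib

/-- The single exponential transformation
`φ_{a,b}(x) = (b - a)/2 * tanh (x/2) + (b + a)/2`, as a function of a complex variable. -/
noncomputable def seMap (a b : ℝ) (x : ℂ) : ℂ :=
  ((b : ℂ) - a) / 2 * Complex.tanh (x / 2) + ((b : ℂ) + a) / 2

/-- The open strip `{z : |Im z| < d}`. -/
def stripDomain (d : ℝ) : Set ℂ := {z : ℂ | |z.im| < d}

/-- The lens-shaped image of the strip under `φ_{a,b}`. For `0 < d < π` the map `φ_{a,b}` has no
pole in the strip, and the image is the bounded simply connected domain
`{z : |arg ((z - a) / (b - z))| < d}` (with `z ≠ a, b`), which contains `(a, b)` and has `a` and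
`b` on its boundary. -/
noncomputable def seDomain (a b d : ℝ) : Set ℂ := seMap a b '' stripDomain d

/-- `f` is analytic and bounded on the open set `D`. -/
def MemHInf (D : Set ℂ) (f : ℂ → ℂ) : Prop :=
  DifferentiableOn ℂ f D ∧ ∃ C : ℝ, ∀ z ∈ D, ‖f z‖ ≤ C

/-- The space `X` of functions that are bounded analytic on `D` and continuous on its closure. -/
def MemX (D : Set ℂ) (f : ℂ → ℂ) : Prop :=
  MemHInf D f ∧ ContinuousOn f (closure D)

/-- `Q(z) = (z - a)(b - z)`. -/
noncomputable def endpointQ (a b : ℝ) (z : ℂ) : ℂ := (z - a) * (b - z)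

/-- The class `L_α(D)`: bounded analytic on `D` with `|f z| ≤ C |Q z| ^ α` there. -/
def MemL (a b α : ℝ) (D : Set ℂ) (f : ℂ → ℂ) : Prop :=
  MemHInf D f ∧ ∃ C : ℝ, 0 < C ∧ ∀ z ∈ D, ‖f z‖ ≤ C * ‖endpointQ a b z‖ ^ α

/-- `G[f]`: the function `f` minus its affine interpolant at `a` and `b`. -/
noncomputable def endpointG (a b : ℝ) (f : ℂ → ℂ) (z : ℂ) : ℂ :=
  f z - (((b : ℂ) - z) / ((b : ℂ) - a) * f a + (z - a) / ((b : ℂ) - a) * f b)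

/-- The class `M_α(D)`: analytic on `D`, continuous on the closure, with `G[f] ∈ L_α(D)`. -/
def MemM (a b α : ℝ) (D : Set ℂ) (f : ℂ → ℂ) : Prop :=
  DifferentiableOn ℂ f D ∧ ContinuousOn f (closure D) ∧ MemL a b α D (endpointG a b f)

/-- `f i ∈ M_α(D)` for every index `i`, with one constant in the bound
`|G[f i] z| ≤ C |Q z| ^ α`. -/
def UniformlyMemM {ι : Type*} (a b α : ℝ) (D : Set ℂ) (f : ι → ℂ → ℂ) : Prop :=
  (∀ i, MemM a b α D (f i)) ∧
    ∃ C : ℝ, 0 < C ∧ ∀ i, ∀ z ∈ D, ‖endpointG a b (f i) z‖ ≤ C * ‖endpointQ a b z‖ ^ α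

/-- `u` is a solution, in the space `X` over `D`, of the weakly singular Urysohn equation
`u t = g t + ∫ s in a..b, |t - s| ^ (-lam) * k t s (u s)` for `t ∈ [a, b]`. The last argument of
the kernel `k` ranges over the closure of `D`, so `u` has its values there. -/
def IsUrysohnSolution (a b lam : ℝ) (D : Set ℂ) (k : ℂ → ℂ → ℂ → ℂ) (g u : ℂ → ℂ) : Prop :=
  MemX D u ∧ Set.MapsTo u (closure D) (closure D) ∧
    ∀ t ∈ Set.Icc a b,
      u t = g t + ∫ s in a..b, ((|t - s| ^ (-lam) : ℝ) : ℂ) * k t s (u s)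

/-!
The equation is only given for real `t`, and boundedness of `u` together with a Hölder estimate at
`a` along `(a, b)` would not give the same exponent in the lens. The proof therefore extends the
integral to a holomorphic function on `D` and estimates the extension.

*Setting.* The lens is `{z | 0 < lensFun a b d z}` (`seDomain_eq`). It is star-shaped about every
point of `[a, b]` and is the interior of its closure. By the open mapping theorem `u` is either
constant, where nothing is to be proved, or maps `D` into `D`. In the latter case
`K z s = k z s (u s)` is bounded and holomorphic in each variable; holomorphy in `s`, which enters
`k` twice, is Osgood's lemma on the diagonal (`differentiableOn_diagonal`).

*Extension.* Splitting the integral at `t` and integrating along segments from `z` to `b` and to `a`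
gives `singularExt`. It is holomorphic on `D` and agrees with the integral on `(a, b)`, so
`u - g = singularExt lam a b K` on `D` by the identity theorem.

*Estimate at `a`.* Put `ρ = ‖z - a‖`. The segment from `z` to `a` contributes `O(ρ ^ (1 - lam))`,
and so does replacing `K z` by `h = K a` on the segment from `z` to `b`. The segment to `b` is then
deformed into the broken line through the real point `p = a + 2 ρ`. The deformation is carried out
as the fundamental theorem of calculus in the endpoint `q` of the segment: by an integration by
parts, the integral of `(s - z) ^ (-lam) * h s` from `z` to `q` has derivative
`(q - z) ^ (-lam) * h q` (`hasDerivAt_cpow_mul_segInt`, `integral_cpow_sub_mul_eq`). On `[p, b]` the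
kernels with singularities at `z` and at `a` differ by `O(ρ * (s - a) ^ (-lam - 1))`, and the short
pieces are `O(ρ ^ (1 - lam))` (`norm_cpow_mul_segInt_sub_le`). The estimate at `b` follows by the
reflection `z ↦ a + b - z`.

Hölder estimates at the endpoints and membership in the class `M` are equivalent for bounded
functions (`norm_sub_endpoint_le`, `memL_endpointG`), and the smaller of the two exponents survives.
-/

open MeasureTheory Filter Topology Set

/-! ### Holomorphic dependence on parameters -/

/-- An integral of functions holomorphic in a parameter, dominated by one integrable function, is
holomorphic in the parameter. The derivative is dominated by Cauchy's estimate. -/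
theorem differentiableOn_integral_of_dominated {α : Type*} [MeasurableSpace α] {μ : Measure α}
    {F : ℂ → α → ℂ} {U : Set ℂ} (hU : IsOpen U) {bound : α → ℝ}
    (hmeas : ∀ z ∈ U, AEStronglyMeasurable (F z) μ) (hint : Integrable bound μ)
    (hb : ∀ᵐ x ∂μ, ∀ z ∈ U, ‖F z x‖ ≤ bound x)
    (hd : ∀ᵐ x ∂μ, DifferentiableOn ℂ (fun z => F z x) U) :
    DifferentiableOn ℂ (fun z => ∫ x, F z x ∂μ) U := by
  intro z₀ hz₀
  obtain ⟨ε, hε, hball⟩ := Metric.isOpen_iff.1 hU z₀ hz₀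
  have hsub : ∀ z ∈ Metric.ball z₀ (ε / 2), Metric.closedBall z (ε / 4) ⊆ U := by
    intro z hz w hw
    apply hball
    rw [Metric.mem_ball] at hz ⊢
    rw [Metric.mem_closedBall] at hw
    linarith [dist_triangle w z z₀]
  -- a sequence tending to `z₀` along which the difference quotients are measurable
  have hseq : Tendsto (fun n : ℕ => z₀ + ((ε / 2 * (1 / ((n : ℝ) + 1)) : ℝ) : ℂ)) atTop
      (𝓝[≠] z₀) := by
    refine tendsto_nhdsWithin_iff.2 ⟨?_, Eventually.of_forall fun n => ?_⟩
    · have h := (tendsto_one_div_add_atTop_nhds_zero_nat (𝕜 := ℝ)).const_mul (ε / 2)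
      have h2 := (Complex.continuous_ofReal.tendsto _).comp h
      simpa using h2.const_add z₀
    · have : (0 : ℝ) < ε / 2 * (1 / ((n : ℝ) + 1)) := by positivity
      simp only [mem_compl_iff, mem_singleton_iff, add_eq_left, Complex.ofReal_eq_zero]
      exact this.ne'
  have hmem : ∀ n : ℕ, z₀ + ((ε / 2 * (1 / ((n : ℝ) + 1)) : ℝ) : ℂ) ∈ U := by
    intro n
    apply hball
    have h1 : (1 : ℝ) / ((n : ℝ) + 1) ≤ 1 := by
      rw [div_le_one (by positivity)]; linarith [(Nat.cast_nonneg n : (0 : ℝ) ≤ n)]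
    have h0 : (0 : ℝ) ≤ 1 / ((n : ℝ) + 1) := by positivity
    rw [Metric.mem_ball, dist_eq_norm, add_sub_cancel_left, Complex.norm_real, Real.norm_eq_abs,
      abs_of_nonneg (by positivity)]
    nlinarith
  have hderiv_meas : AEStronglyMeasurable (fun x => deriv (fun z => F z x) z₀) μ := by
    refine aestronglyMeasurable_of_tendsto_ae atTop
      (f := fun (n : ℕ) x => slope (fun z => F z x) z₀ (z₀ + ((ε / 2 * (1 / ((n : ℝ) + 1)) : ℝ) : ℂ)))
      (fun n => ?_) ?_
    · simp only [slope_def_field, div_eq_mul_inv]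
      exact ((hmeas _ (hmem n)).sub (hmeas _ hz₀)).mul_const _
    · filter_upwards [hd] with x hx
      have := ((hx.differentiableAt (hU.mem_nhds hz₀)).hasDerivAt).tendsto_slope
      exact this.comp hseq
  have := hasDerivAt_integral_of_dominated_loc_of_deriv_le (μ := μ) (F := F)
    (F' := fun z x => deriv (fun z => F z x) z) (bound := fun x => bound x / (ε / 4))
    (s := Metric.ball z₀ (ε / 2)) (x₀ := z₀) (Metric.ball_mem_nhds _ (by positivity))
    (by filter_upwards [hU.mem_nhds hz₀] with z hz using hmeas z hz)
    (hint.mono' (hmeas _ hz₀) (by filter_upwards [hb] with x hx using hx _ hz₀))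
    hderiv_meas
    (by
      filter_upwards [hb, hd] with x hx hdx z hz
      refine Complex.norm_deriv_le_of_forall_mem_sphere_norm_le (by positivity)
        ((hdx.mono (hsub z hz)).diffContOnCl_ball subset_rfl) fun w hw => hx w ?_
      exact hsub z hz (Metric.sphere_subset_closedBall hw))
    (hint.div_const _)
    (by
      filter_upwards [hd] with x hdx z hz
      exact (hdx.differentiableAt (hU.mem_nhds
        (hsub z hz (Metric.mem_closedBall_self (by positivity))))).hasDerivAt)
  exact this.2.differentiableAt.differentiableWithinAt

/-- A bounded separately holomorphic function of two variables is holomorphic on the diagonal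
(a case of Osgood's lemma). Cauchy's formula in the second variable turns the diagonal into an
integral of functions holomorphic in the parameter. -/
theorem differentiableOn_diagonal {D : Set ℂ} (hD : IsOpen D) {f : ℂ → ℂ → ℂ} {M : ℝ}
    (hM : ∀ z ∈ D, ∀ w ∈ D, ‖f z w‖ ≤ M)
    (h1 : ∀ w ∈ D, DifferentiableOn ℂ (fun z => f z w) D)
    (h2 : ∀ z ∈ D, DifferentiableOn ℂ (f z) D) :
    DifferentiableOn ℂ (fun z => f z z) D := by
  intro z₀ hz₀
  obtain ⟨ε, hε, hball⟩ := Metric.nhds_basis_closedBall.mem_iff.1 (hD.mem_nhds hz₀)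
  have hcirc : ∀ θ : ℝ, circleMap z₀ ε θ ∈ D := fun θ =>
    hball (Metric.sphere_subset_closedBall (circleMap_mem_sphere _ hε.le _))
  have hin : ∀ z ∈ Metric.ball z₀ (ε / 2), z ∈ D := fun z hz =>
    hball (Metric.ball_subset_closedBall (Metric.ball_subset_ball (by linarith) hz))
  have hdist : ∀ z ∈ Metric.ball z₀ (ε / 2), ∀ θ : ℝ, ε / 2 ≤ ‖circleMap z₀ ε θ - z‖ := by
    intro z hz θ
    have h := dist_triangle (circleMap z₀ ε θ) z z₀
    rw [Metric.mem_sphere.1 (circleMap_mem_sphere z₀ hε.le θ)] at h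
    rw [Metric.mem_ball] at hz
    rw [← dist_eq_norm]
    linarith
  have hM0 : 0 ≤ M := (norm_nonneg _).trans (hM z₀ hz₀ z₀ hz₀)
  have key : DifferentiableOn ℂ (fun z => ∫ θ in Ioc 0 (2 * Real.pi),
      deriv (circleMap z₀ ε) θ • ((circleMap z₀ ε θ - z)⁻¹ • f z (circleMap z₀ ε θ)))
      (Metric.ball z₀ (ε / 2)) := by
    refine differentiableOn_integral_of_dominated Metric.isOpen_ball
      (bound := fun _ => ε * ((ε / 2)⁻¹ * M)) ?_ ?_ ?_ ?_
    · intro z hz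
      have hne : ∀ θ, circleMap z₀ ε θ - z ≠ 0 := fun θ => by
        rw [← norm_pos_iff]; exact (half_pos hε).trans_le (hdist z hz θ)
      have hc : Continuous fun θ => f z (circleMap z₀ ε θ) :=
        (h2 z (hin z hz)).continuousOn.comp_continuous (continuous_circleMap _ _) hcirc
      simp only [deriv_circleMap]
      refine Continuous.aestronglyMeasurable ?_
      exact ((continuous_circleMap 0 ε).mul continuous_const).smul
        ((((continuous_circleMap _ _).sub continuous_const).inv₀ hne).smul hc)
    · exact integrable_const _
    · refine Eventually.of_forall fun θ z hz => ?_
      rw [norm_smul, norm_smul, norm_inv]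
      have e1 : ‖deriv (circleMap z₀ ε) θ‖ = ε := by
        simp [deriv_circleMap, abs_of_pos hε]
      rw [e1]
      gcongr
      · exact hdist z hz θ
      · exact hM _ (hin z hz) _ (hcirc θ)
    · refine Eventually.of_forall fun θ z hz => ?_
      have hne : circleMap z₀ ε θ - z ≠ 0 := by
        rw [← norm_pos_iff]; exact (half_pos hε).trans_le (hdist z hz θ)
      have hf : DifferentiableAt ℂ (fun z => f z (circleMap z₀ ε θ)) z :=
        (h1 _ (hcirc θ)).differentiableAt (hD.mem_nhds (hin z hz))
      have hi : DifferentiableAt ℂ (fun z => (circleMap z₀ ε θ - z)⁻¹) z :=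
        ((differentiableAt_const _).sub differentiableAt_id).inv hne
      exact ((hi.smul hf).const_smul (deriv (circleMap z₀ ε) θ)).differentiableWithinAt
  have heq : ∀ z ∈ Metric.ball z₀ (ε / 2), f z z = (2 * Real.pi * Complex.I : ℂ)⁻¹ •
      ∫ θ in Ioc 0 (2 * Real.pi),
      deriv (circleMap z₀ ε) θ • ((circleMap z₀ ε θ - z)⁻¹ • f z (circleMap z₀ ε θ)) := by
    intro z hz
    have hzD := hin z hz
    have := Complex.two_pi_I_inv_smul_circleIntegral_sub_inv_smul_of_differentiable_on_off_countable
      (R := ε) (c := z₀) (w := z) (f := f z) (s := ∅) countable_empty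
      (Metric.ball_subset_ball (by linarith) hz) ((h2 z hzD).continuousOn.mono hball)
      (fun x hx => (h2 z hzD).differentiableAt
        (hD.mem_nhds (hball (Metric.ball_subset_closedBall hx.1))))
    rw [← this, circleIntegral, intervalIntegral.integral_of_le (by positivity)]
  have h3 : DifferentiableOn ℂ (fun z => f z z) (Metric.ball z₀ (ε / 2)) :=
    (key.const_smul (2 * Real.pi * Complex.I : ℂ)⁻¹).congr heq
  exact (h3.differentiableAt (Metric.ball_mem_nhds _ (half_pos hε))).differentiableWithinAt

/-- A holomorphic map of a domain `D` into its closure is constant or maps `D` to itself, when `D`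
is the interior of its closure: this is the open mapping theorem. -/
theorem eqOn_const_or_mapsTo_of_mapsTo_closure {D : Set ℂ} (hD : IsOpen D)
    (hconn : IsPreconnected D) (hreg : interior (closure D) ⊆ D) {u : ℂ → ℂ}
    (hu : DifferentiableOn ℂ u D) (hmaps : MapsTo u D (closure D)) :
    (∃ w, ∀ z ∈ D, u z = w) ∨ MapsTo u D D := by
  refine ((hu.analyticOnNhd hD).is_constant_or_isOpen hconn).imp id fun h z hz => ?_
  exact hreg (interior_maximal hmaps.image_subset (h D subset_rfl hD) (mem_image_of_mem u hz))

/-! ### Geometry of the lens -/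

/-- A defining function of the lens `seDomain a b d`: with `N = (z - a) * conj (b - z)`, it is
`sin d * re N - cos d * |im N| = ‖N‖ * sin (d - |arg N|)`. -/
noncomputable def lensFun (a b d : ℝ) (z : ℂ) : ℝ :=
  Real.sin d * ((z.re - a) * (b - z.re) - z.im ^ 2) - Real.cos d * ((b - a) * |z.im|)

theorem continuous_lensFun (a b d : ℝ) : Continuous (lensFun a b d) := by
  unfold lensFun
  have h1 := Complex.continuous_re
  have h2 := Complex.continuous_im
  fun_prop

theorem lensFun_reflect (a b d : ℝ) (z : ℂ) : lensFun a b d (a + b - z) = lensFun a b d z := by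
  simp only [lensFun, Complex.sub_re, Complex.add_re, Complex.ofReal_re, Complex.sub_im,
    Complex.add_im, Complex.ofReal_im, add_zero, zero_sub, abs_neg]
  ring

theorem lensFun_ofReal (a b d x : ℝ) :
    lensFun a b d x = Real.sin d * ((x - a) * (b - x)) := by
  simp [lensFun]

/-- If `(z - a) / (b - z) = exp x`, the defining function of the lens is a positive multiple of
`sin d * cos (im x) - cos d * |sin (im x)|`. -/
theorem lensFun_eq_of_exp {a b d : ℝ} (hab : a < b) {z x : ℂ}
    (hx : z - a = Complex.exp x * (b - z)) :
    lensFun a b d z = Complex.normSq (b - z) * Real.exp x.re *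
      (Real.sin d * Real.cos x.im - Real.cos d * |Real.sin x.im|) := by
  have hN : (z - a) * (starRingEnd ℂ) (b - z) = Complex.normSq (b - z) * Complex.exp x := by
    rw [hx, Complex.normSq_eq_conj_mul_self]; ring
  have hre := congrArg Complex.re hN
  have him := congrArg Complex.im hN
  simp only [Complex.mul_re, Complex.mul_im, Complex.sub_re, Complex.sub_im, Complex.ofReal_re,
    Complex.ofReal_im, Complex.conj_re, Complex.conj_im, Complex.exp_re, Complex.exp_im] at hre him
  have h1 : (z.re - a) * (b - z.re) - z.im ^ 2 =
      Complex.normSq (b - z) * (Real.exp x.re * Real.cos x.im) := by linarith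
  have h2 : (b - a) * z.im = Complex.normSq (b - z) * (Real.exp x.re * Real.sin x.im) := by
    linarith
  have h3 : (b - a) * |z.im| = Complex.normSq (b - z) * (Real.exp x.re * |Real.sin x.im|) := by
    have := congrArg abs h2
    rwa [abs_mul, abs_mul, abs_mul, abs_of_pos (sub_pos.2 hab), abs_of_nonneg
      (Complex.normSq_nonneg _), abs_of_pos (Real.exp_pos _)] at this
  rw [lensFun, h1, h3]
  ring

theorem sin_mul_cos_sub_eq {d y : ℝ} (hy : |y| ≤ Real.pi) :
    Real.sin d * Real.cos y - Real.cos d * |Real.sin y| = Real.sin (d - |y|) := by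
  rw [Real.sin_sub, Real.cos_abs]
  congr 2
  rcases abs_cases y with ⟨h, h0⟩ | ⟨h, h0⟩
  · rw [h, abs_of_nonneg (Real.sin_nonneg_of_nonneg_of_le_pi h0 (h ▸ hy))]
  · rw [h, Real.sin_neg, abs_of_nonpos]
    rw [h] at hy
    exact Real.sin_nonpos_of_nonpos_of_neg_pi_le h0.le (by linarith)

theorem one_add_exp_ne_zero {x : ℂ} (hx : |x.im| < Real.pi) : 1 + Complex.exp x ≠ 0 := by
  intro h
  have him := congrArg Complex.im h
  have hre := congrArg Complex.re h
  simp only [Complex.add_re, Complex.add_im, Complex.exp_re, Complex.exp_im, Complex.one_re,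
    Complex.one_im, Complex.zero_re, Complex.zero_im] at hre him
  have hs : Real.sin x.im = 0 := by
    have := Real.exp_pos x.re
    rcases mul_eq_zero.1 (show Real.exp x.re * Real.sin x.im = 0 by linarith) with h | h
    · linarith
    · exact h
  have h0 : x.im = 0 := by
    have h1 := abs_lt.1 hx
    exact (Real.sin_eq_zero_iff_of_lt_of_lt h1.1 h1.2).1 hs
  rw [h0, Real.cos_zero] at hre
  linarith [Real.exp_pos x.re]

/-- The single exponential map in terms of `exp x`. -/
theorem seMap_eq {a b : ℝ} {x : ℂ} (hx : 1 + Complex.exp x ≠ 0) :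
    seMap a b x = (a + b * Complex.exp x) / (1 + Complex.exp x) := by
  have h2 : Complex.exp x = Complex.exp (x / 2) * Complex.exp (x / 2) := by
    rw [← Complex.exp_add]; ring_nf
  have h3 : Complex.exp (-(x / 2)) * Complex.exp (x / 2) = 1 := by
    rw [← Complex.exp_add]; simp
  have hE := Complex.exp_ne_zero (x / 2)
  have hcosh : Complex.cosh (x / 2) * (2 * Complex.exp (x / 2)) = 1 + Complex.exp x := by
    rw [Complex.cosh, h2]; linear_combination h3
  have hsinh : Complex.sinh (x / 2) * (2 * Complex.exp (x / 2)) = Complex.exp x - 1 := by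
    rw [Complex.sinh, h2]; linear_combination -h3
  have htanh : Complex.tanh (x / 2) = (Complex.exp x - 1) / (1 + Complex.exp x) := by
    rw [Complex.tanh_eq_sinh_div_cosh, ← hcosh, ← hsinh,
      mul_div_mul_right _ _ (mul_ne_zero two_ne_zero hE)]
  rw [seMap, htanh]
  field_simp
  ring

/-- The lens is the set where its defining function is positive. -/
theorem seDomain_eq {a b d : ℝ} (hab : a < b) (hd0 : 0 < d) (hdπ : d < Real.pi) :
    seDomain a b d = {z | 0 < lensFun a b d z} := by
  have hab' : (b : ℂ) - a ≠ 0 := by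
    rw [sub_ne_zero]; exact_mod_cast hab.ne'
  ext z
  simp only [seDomain, mem_image, stripDomain, mem_ofPred_eq]
  constructor
  · rintro ⟨x, hx, rfl⟩
    have hne := one_add_exp_ne_zero (hx.trans hdπ)
    have hbz : (b : ℂ) - seMap a b x = (b - a) / (1 + Complex.exp x) := by
      rw [seMap_eq hne]; field_simp; ring
    have hza : seMap a b x - a = Complex.exp x * (b - seMap a b x) := by
      rw [hbz, seMap_eq hne]; field_simp; ring
    rw [lensFun_eq_of_exp hab hza, sin_mul_cos_sub_eq (hx.trans hdπ).le]
    have h1 : 0 < Complex.normSq (b - seMap a b x) := by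
      rw [Complex.normSq_pos, hbz]; exact div_ne_zero hab' hne
    have h2 : 0 < Real.sin (d - |x.im|) :=
      Real.sin_pos_of_pos_of_lt_pi (by linarith) (by linarith [abs_nonneg x.im])
    have := Real.exp_pos x.re
    positivity
  · intro hz
    have hzb : (b : ℂ) - z ≠ 0 := by
      intro h
      rw [show z = (b : ℂ) by linear_combination -h, lensFun_ofReal] at hz
      simp at hz
    have hza : z - a ≠ 0 := by
      intro h
      rw [show z = (a : ℂ) by linear_combination h, lensFun_ofReal] at hz
      simp at hz
    have hexp : Complex.exp (Complex.log ((z - a) / (b - z))) = (z - a) / (b - z) :=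
      Complex.exp_log (div_ne_zero hza hzb)
    have hN : z - a = Complex.exp (Complex.log ((z - a) / (b - z))) * (b - z) := by
      rw [hexp]; field_simp
    refine ⟨Complex.log ((z - a) / (b - z)), ?_, ?_⟩
    · rw [lensFun_eq_of_exp hab hN, sin_mul_cos_sub_eq
        (by rw [Complex.log_im]; exact Complex.abs_arg_le_pi _)] at hz
      have h1 : 0 < Real.sin (d - |(Complex.log ((z - a) / (b - z))).im|) := by
        refine pos_of_mul_pos_right hz ?_
        exact mul_nonneg (Complex.normSq_nonneg _) (Real.exp_pos _).le
      by_contra! hcon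
      have h2 := Complex.abs_arg_le_pi ((z - a) / (b - z))
      rw [← Complex.log_im] at h2
      exact h1.not_ge (Real.sin_nonpos_of_nonpos_of_neg_pi_le (by linarith) (by linarith))
    · have h1 : 1 + (z - a) / (b - z) = (b - a) / (b - z) := by field_simp; ring
      have hne : 1 + Complex.exp (Complex.log ((z - a) / (b - z))) ≠ 0 := by
        rw [hexp, h1]; exact div_ne_zero hab' hzb
      rw [seMap_eq hne, hexp, h1]
      field_simp
      ring

section Lens

variable {a b d : ℝ}

theorem isOpen_lens (a b d : ℝ) : IsOpen {z | 0 < lensFun a b d z} :=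
  isOpen_lt continuous_const (continuous_lensFun a b d)

theorem ofReal_mem_lens (hd0 : 0 < d) (hdπ : d < Real.pi) {x : ℝ} (hx : x ∈ Ioo a b) :
    0 < lensFun a b d x := by
  rw [lensFun_ofReal]
  have := Real.sin_pos_of_pos_of_lt_pi hd0 hdπ
  have h1 := sub_pos.2 hx.1
  have h2 := sub_pos.2 hx.2
  positivity

/-- The lens is star-shaped about every point of `[a, b]`: along segments ending there the defining
function is concave, although it need not be concave everywhere. -/
theorem lensFun_segment_pos (hd0 : 0 < d) (hdπ : d < Real.pi) {z : ℂ}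
    (hz : 0 < lensFun a b d z) {p : ℝ} (hp : p ∈ Icc a b) {τ : ℝ} (h0 : 0 ≤ τ) (h1 : τ < 1) :
    0 < lensFun a b d (z + τ * (p - z)) := by
  have hs := Real.sin_pos_of_pos_of_lt_pi hd0 hdπ
  have him : (z + τ * (p - z)).im = (1 - τ) * z.im := by simp; ring
  have hre : (z + τ * (p - z)).re = (1 - τ) * z.re + τ * p := by simp; ring
  have hconc : lensFun a b d (z + τ * (p - z)) = (1 - τ) * lensFun a b d z +
      τ * (Real.sin d * ((p - a) * (b - p))) +
      Real.sin d * (τ * (1 - τ) * ((z.re - p) ^ 2 + z.im ^ 2)) := by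
    simp only [lensFun, him, hre, abs_mul, abs_of_pos (sub_pos.2 h1)]
    ring
  rw [hconc]
  have h2 := sub_pos.2 h1
  have h3 := sub_nonneg.2 hp.1
  have h4 := sub_nonneg.2 hp.2
  have : 0 < (1 - τ) * lensFun a b d z := mul_pos h2 hz
  positivity

theorem isPreconnected_lens (hab : a < b) (hd0 : 0 < d) (hdπ : d < Real.pi) :
    IsPreconnected {z | 0 < lensFun a b d z} := by
  have hp : (a + b) / 2 ∈ Ioo a b := ⟨by linarith, by linarith⟩
  have hstar : StarConvex ℝ (((a + b) / 2 : ℝ) : ℂ) {z | 0 < lensFun a b d z} := by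
    intro z hz s t hs ht hst
    rcases ht.eq_or_lt with rfl | ht
    · rw [add_zero] at hst
      simpa [hst] using ofReal_mem_lens hd0 hdπ hp
    · have := lensFun_segment_pos hd0 hdπ hz ⟨hp.1.le, hp.2.le⟩ hs (by linarith)
      rw [mem_ofPred_eq]
      convert this using 2
      simp only [Complex.real_smul]
      rw [show t = 1 - s by linarith]
      push_cast
      ring
  exact (hstar.isPathConnected (ofReal_mem_lens hd0 hdπ hp)).isConnected.isPreconnected

/-- Moving a boundary point away from the vertical line through the midpoint leaves the closed
lens, so the lens is the interior of its closure. -/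
theorem interior_closure_lens_subset (hd0 : 0 < d) (hdπ : d < Real.pi) :
    interior (closure {z | 0 < lensFun a b d z}) ⊆ {z | 0 < lensFun a b d z} := by
  have hcl : closure {z | 0 < lensFun a b d z} ⊆ {z | 0 ≤ lensFun a b d z} :=
    closure_minimal (fun z (hz : 0 < lensFun a b d z) => hz.le) (isClosed_le continuous_const
      (continuous_lensFun a b d))
  intro w hw
  have hs := Real.sin_pos_of_pos_of_lt_pi hd0 hdπ
  obtain ⟨ε, hε, hball⟩ := Metric.isOpen_iff.1 isOpen_interior w hw
  have hshift : ∀ t : ℝ, |t| < ε → 0 ≤ lensFun a b d (w + t) := fun t ht =>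
    hcl (interior_subset (hball (by simpa [Metric.mem_ball, dist_eq_norm] using ht)))
  have hval : ∀ t : ℝ, lensFun a b d (w + t) = lensFun a b d w -
      Real.sin d * (t ^ 2 + t * (2 * w.re - a - b)) := by
    intro t
    simp only [lensFun, Complex.add_re, Complex.ofReal_re, Complex.add_im, Complex.ofReal_im,
      add_zero]
    ring
  have hhalf : |ε / 2| < ε := by rw [abs_of_pos (half_pos hε)]; linarith
  rw [mem_ofPred_eq]
  rcases le_total 0 (2 * w.re - a - b) with h | h
  · have h1 := hshift (ε / 2) hhalf
    rw [hval] at h1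
    have : 0 < Real.sin d * ((ε / 2) ^ 2 + ε / 2 * (2 * w.re - a - b)) := by positivity
    linarith
  · have h1 := hshift (-(ε / 2)) (by rwa [abs_neg])
    rw [hval] at h1
    have : 0 < Real.sin d * ((-(ε / 2)) ^ 2 + -(ε / 2) * (2 * w.re - a - b)) := by
      rw [neg_sq]
      refine mul_pos hs (add_pos_of_pos_of_nonneg (by positivity) ?_)
      exact mul_nonneg_of_nonpos_of_nonpos (by linarith) h
    linarith

/-- On the lens neither `b - z` nor, by symmetry, `z - a` meets the branch cut. -/
theorem sub_mem_slitPlane_of_lens (hab : a < b) (hd0 : 0 < d) (hdπ : d < Real.pi) {z : ℂ}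
    (hz : 0 < lensFun a b d z) : (b : ℂ) - z ∈ Complex.slitPlane := by
  rw [Complex.mem_slitPlane_iff]
  by_contra! h
  simp only [Complex.sub_re, Complex.ofReal_re, Complex.sub_im, Complex.ofReal_im, zero_sub,
    neg_eq_zero] at h
  have hs := Real.sin_pos_of_pos_of_lt_pi hd0 hdπ
  simp only [lensFun, h.2] at hz
  have : (z.re - a) * (b - z.re) ≤ 0 := mul_nonpos_of_nonneg_of_nonpos (by linarith) h.1
  simp at hz
  nlinarith

theorem closure_lens_of_mem_Icc (hab : a < b) (hd0 : 0 < d) (hdπ : d < Real.pi) {x : ℝ}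
    (hx : x ∈ Icc a b) : (x : ℂ) ∈ closure {z | 0 < lensFun a b d z} := by
  rw [← closure_Ioo hab.ne] at hx
  exact map_mem_closure Complex.continuous_ofReal hx fun y hy => ofReal_mem_lens hd0 hdπ hy

theorem exists_norm_le_of_lens (a b : ℝ) (hd0 : 0 < d) (hdπ : d < Real.pi) :
    ∃ R : ℝ, ∀ z, 0 < lensFun a b d z → ‖z‖ ≤ R := by
  have hs := Real.sin_pos_of_pos_of_lt_pi hd0 hdπ
  set c := (Real.cos d * (b - a)) / Real.sin d with hc
  -- completing squares, each half of the lens lies in a disc of squared radius `L`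
  set L := (b - a) ^ 2 / 4 + c ^ 2 / 4 with hL
  refine ⟨|(a + b) / 2| + L + 1 + (|c| / 2 + L + 1), fun z hz => ?_⟩
  have h1 : 0 < (z.re - a) * (b - z.re) - z.im ^ 2 - c * |z.im| := by
    have : lensFun a b d z = Real.sin d * ((z.re - a) * (b - z.re) - z.im ^ 2 - c * |z.im|) := by
      rw [lensFun, hc]; field_simp
    rw [this] at hz
    exact pos_of_mul_pos_right hz hs.le
  have h2 : (z.re - (a + b) / 2) ^ 2 + (|z.im| + c / 2) ^ 2 ≤ L := by
    rw [hL]; nlinarith [sq_abs z.im]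
  have h3 : |z.re - (a + b) / 2| ≤ L + 1 := by
    refine abs_le_of_sq_le_sq ?_ (by positivity)
    nlinarith [sq_nonneg (|z.im| + c / 2), sq_nonneg L, sq_nonneg (z.re - (a + b) / 2)]
  have h4 : |(|z.im| + c / 2)| ≤ L + 1 := by
    refine abs_le_of_sq_le_sq ?_ (by positivity)
    nlinarith [sq_nonneg (|z.im| + c / 2), sq_nonneg L, sq_nonneg (z.re - (a + b) / 2)]
  have h5 : |z.re| ≤ |(a + b) / 2| + L + 1 := by
    have := abs_add_le (z.re - (a + b) / 2) ((a + b) / 2)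
    rw [sub_add_cancel] at this
    linarith
  have h6 : |z.im| ≤ |c| / 2 + L + 1 := by
    have := le_of_abs_le h4
    have := neg_abs_le c
    linarith
  linarith [Complex.norm_le_abs_re_add_abs_im z]

end Lens

/-! ### Weakly singular integrals along segments -/

/-- The weakly singular integral `∫ τ in (0, 1), τ ^ (-lam) * h (z + τ (q - z))` of `h` along the
segment from `z` to `q`. With the factor `(q - z) ^ (1 - lam)` it becomes the integral of
`(s - z) ^ (-lam) * h s` along the segment. -/
noncomputable def segInt (lam : ℝ) (h : ℂ → ℂ) (q z : ℂ) : ℂ :=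
  ∫ τ in Ioo (0 : ℝ) 1, ((τ ^ (-lam) : ℝ) : ℂ) * h (z + τ * (q - z))

/-- The geometric properties of the lens on which segment integrals rest: `D` is open, contains the
open interval `(a, b)`, and is star-shaped about every point of `[a, b]`, where the endpoint of a
segment is not required to belong to `D`. -/
structure StarAboutInterval (a b : ℝ) (D : Set ℂ) : Prop where
  isOpen : IsOpen D
  ofReal_mem : ∀ x ∈ Ioo a b, (x : ℂ) ∈ D
  segment_mem : ∀ z ∈ D, ∀ p ∈ Icc a b, ∀ τ : ℝ, 0 ≤ τ → τ < 1 → z + τ * ((p : ℂ) - z) ∈ D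

section SegInt

variable {lam : ℝ}

theorem integrableOn_rpow_neg (hlam1 : lam < 1) :
    IntegrableOn (fun τ : ℝ => τ ^ (-lam)) (Ioo 0 1) := by
  have := intervalIntegral.intervalIntegrable_rpow' (a := 0) (b := 1) (r := -lam) (by linarith)
  rwa [intervalIntegrable_iff_integrableOn_Ioo_of_le zero_le_one] at this

theorem setIntegral_rpow_neg (hlam1 : lam < 1) :
    ∫ τ in Ioo (0 : ℝ) 1, τ ^ (-lam) = 1 / (1 - lam) := by
  rw [← integral_Ioc_eq_integral_Ioo, ← intervalIntegral.integral_of_le zero_le_one,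
    integral_rpow (Or.inl (by linarith)), Real.one_rpow, Real.zero_rpow (by linarith)]
  ring_nf

theorem norm_rpow_mul_le {τ M : ℝ} (hτ : 0 < τ) {w : ℂ} (hw : ‖w‖ ≤ M) :
    ‖((τ ^ (-lam) : ℝ) : ℂ) * w‖ ≤ τ ^ (-lam) * M := by
  rw [norm_mul, Complex.norm_real, Real.norm_of_nonneg (Real.rpow_nonneg hτ.le _)]
  gcongr

theorem norm_segInt_le (hlam1 : lam < 1) {h : ℂ → ℂ} {q z : ℂ} {M : ℝ}
    (hM : ∀ τ ∈ Ioo (0 : ℝ) 1, ‖h (z + τ * (q - z))‖ ≤ M) :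
    ‖segInt lam h q z‖ ≤ M / (1 - lam) := by
  have h1 := norm_integral_le_of_norm_le (μ := volume.restrict (Ioo (0 : ℝ) 1))
    (f := fun τ : ℝ => ((τ ^ (-lam) : ℝ) : ℂ) * h (z + τ * (q - z)))
    ((integrableOn_rpow_neg hlam1).mul_const M)
    (ae_restrict_of_forall_mem measurableSet_Ioo fun τ hτ => norm_rpow_mul_le hτ.1 (hM τ hτ))
  rw [integral_mul_const, setIntegral_rpow_neg hlam1] at h1
  rw [segInt]
  linarith [h1, show 1 / (1 - lam) * M = M / (1 - lam) by ring]

theorem aestronglyMeasurable_segment {h : ℂ → ℂ} {D : Set ℂ} (hh : ContinuousOn h D) {q z : ℂ}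
    (hseg : ∀ τ ∈ Ioo (0 : ℝ) 1, z + τ * (q - z) ∈ D) (r : ℝ) :
    AEStronglyMeasurable (fun τ : ℝ => ((τ ^ r : ℝ) : ℂ) * h (z + τ * (q - z)))
      (volume.restrict (Ioo (0 : ℝ) 1)) := by
  refine ContinuousOn.aestronglyMeasurable ?_ measurableSet_Ioo
  refine ContinuousOn.mul ?_ ?_
  · refine Complex.continuous_ofReal.comp_continuousOn ?_
    exact ContinuousOn.rpow_const continuousOn_id fun x hx => Or.inl hx.1.ne'
  · exact hh.comp (by fun_prop) hseg

theorem integrableOn_segment (hlam1 : lam < 1) {h : ℂ → ℂ} {D : Set ℂ} (hh : ContinuousOn h D)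
    {q z : ℂ} (hseg : ∀ τ ∈ Ioo (0 : ℝ) 1, z + τ * (q - z) ∈ D) {M : ℝ}
    (hM : ∀ s ∈ D, ‖h s‖ ≤ M) :
    IntegrableOn (fun τ : ℝ => ((τ ^ (-lam) : ℝ) : ℂ) * h (z + τ * (q - z))) (Ioo (0 : ℝ) 1) :=
  Integrable.mono' ((integrableOn_rpow_neg hlam1).mul_const M)
    (aestronglyMeasurable_segment hh hseg _)
    (ae_restrict_of_forall_mem measurableSet_Ioo fun τ hτ =>
      norm_rpow_mul_le hτ.1 (hM _ (hseg τ hτ)))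

variable {a b : ℝ} {D : Set ℂ}

/-- The segment integral, ending at a point about which `D` is star-shaped, is holomorphic in its
starting point even if the integrand depends holomorphically on that point. -/
theorem differentiableOn_segInt (hlam1 : lam < 1) (hD : IsOpen D) {q : ℂ}
    (hseg : ∀ z ∈ D, ∀ τ ∈ Ioo (0 : ℝ) 1, z + τ * (q - z) ∈ D) {K : ℂ → ℂ → ℂ} {M : ℝ}
    (hM : ∀ z ∈ D, ∀ s ∈ D, ‖K z s‖ ≤ M)
    (h1 : ∀ s ∈ D, DifferentiableOn ℂ (fun z => K z s) D)
    (h2 : ∀ z ∈ D, DifferentiableOn ℂ (K z) D) :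
    DifferentiableOn ℂ (fun z => segInt lam (K z) q z) D := by
  refine differentiableOn_integral_of_dominated hD (bound := fun τ => τ ^ (-lam) * M)
    (fun z hz => aestronglyMeasurable_segment (h2 z hz).continuousOn (hseg z hz) _)
    ((integrableOn_rpow_neg hlam1).mul_const M)
    (ae_restrict_of_forall_mem measurableSet_Ioo fun τ hτ z hz =>
      norm_rpow_mul_le hτ.1 (hM _ hz _ (hseg z hz τ hτ)))
    (ae_restrict_of_forall_mem measurableSet_Ioo fun τ hτ => ?_)
  refine DifferentiableOn.const_mul ?_ _
  refine differentiableOn_diagonal hD (f := fun z w => K z (w + τ * (q - w)))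
    (fun z hz w hw => hM z hz _ (hseg w hw τ hτ)) (fun w hw => h1 _ (hseg w hw τ hτ))
    fun z hz => ?_
  exact (h2 z hz).comp (by fun_prop) fun w hw => hseg w hw τ hτ

/-- On the real line the segment integral is the weakly singular integral. -/
theorem integral_abs_sub_rpow_mul_eq (h : ℂ → ℂ) (x q : ℝ) :
    ∫ s in x..q, ((|x - s| ^ (-lam) : ℝ) : ℂ) * h s =
      ((q - x) * |q - x| ^ (-lam) : ℝ) * segInt lam h q x := by
  have h1 := intervalIntegral.smul_integral_comp_add_mul (a := 0) (b := 1)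
    (fun s : ℝ => ((|x - s| ^ (-lam) : ℝ) : ℂ) * h s) (q - x) x
  rw [mul_zero, add_zero, mul_one, add_sub_cancel] at h1
  rw [← h1, intervalIntegral.integral_of_le zero_le_one, integral_Ioc_eq_integral_Ioo, segInt,
    Complex.ofReal_mul, mul_assoc, ← integral_const_mul, Complex.real_smul]
  congr 1
  refine setIntegral_congr_fun measurableSet_Ioo fun τ hτ => ?_
  have h2 : |x - (x + (q - x) * τ)| ^ (-lam) = |q - x| ^ (-lam) * τ ^ (-lam) := by
    rw [← Real.mul_rpow (abs_nonneg _) hτ.1.le, ← abs_of_pos hτ.1, ← abs_mul, abs_sub_comm,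
      add_sub_cancel_left, abs_of_pos hτ.1]
  simp only [h2]
  push_cast
  ring_nf

theorem intervalIntegrable_abs_sub_rpow (hlam1 : lam < 1) (t x y : ℝ) :
    IntervalIntegrable (fun s : ℝ => |t - s| ^ (-lam)) volume x y := by
  have hpos : ∀ y : ℝ, 0 ≤ y → IntervalIntegrable (fun s : ℝ => |s| ^ (-lam)) volume 0 y := by
    intro y hy
    refine (intervalIntegral.intervalIntegrable_rpow' (by linarith : -1 < -lam)).congr ?_
    intro s hs
    rw [uIoc_of_le hy] at hs
    simp only [abs_of_pos hs.1]
  have hall : ∀ y : ℝ, IntervalIntegrable (fun s : ℝ => |s| ^ (-lam)) volume 0 y := by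
    intro y
    rcases le_total 0 y with hy | hy
    · exact hpos y hy
    · rw [IntervalIntegrable.iff_comp_neg]
      simpa using hpos (-y) (by linarith)
  have := ((hall (t - x)).symm.trans (hall (t - y))).comp_sub_left t
  simpa using this

/-- The integrand of the weakly singular integral is integrable, wherever the singularity. -/
theorem integrableOn_abs_sub_rpow_mul (hlam1 : lam < 1) (hab : a ≤ b)
    (hIoo : ∀ x ∈ Ioo a b, (x : ℂ) ∈ D) {h : ℂ → ℂ} (hh : ContinuousOn h D) {M : ℝ}
    (hM : ∀ s ∈ D, ‖h s‖ ≤ M) (t : ℝ) :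
    IntegrableOn (fun s : ℝ => ((|t - s| ^ (-lam) : ℝ) : ℂ) * h s) (Ioo a b) := by
  have h1 := (intervalIntegrable_abs_sub_rpow hlam1 t a b).mul_const M
  rw [intervalIntegrable_iff_integrableOn_Ioo_of_le hab] at h1
  refine Integrable.mono' h1 (AEStronglyMeasurable.mul ?_ ?_)
    (ae_restrict_of_forall_mem measurableSet_Ioo fun s hs => ?_)
  · have : Measurable fun s : ℝ => ((|t - s| ^ (-lam) : ℝ) : ℂ) := by fun_prop
    exact this.aestronglyMeasurable
  · exact (hh.comp (f := fun s : ℝ => (s : ℂ)) (by fun_prop) hIoo).aestronglyMeasurable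
      measurableSet_Ioo
  · rw [norm_mul, Complex.norm_real, Real.norm_of_nonneg (Real.rpow_nonneg (abs_nonneg _) _)]
    exact mul_le_mul_of_nonneg_left (hM _ (hIoo s hs)) (Real.rpow_nonneg (abs_nonneg _) _)

/-- The segment integral is continuous in its endpoint, up to the boundary of `D`. -/
theorem continuousOn_segInt_endpoint (hlam1 : lam < 1) (hD : StarAboutInterval a b D)
    {h : ℂ → ℂ} (hh : ContinuousOn h D) {M : ℝ} (hM : ∀ s ∈ D, ‖h s‖ ≤ M) {z : ℂ} (hz : z ∈ D) :
    ContinuousOn (fun q : ℝ => segInt lam h q z) (Icc a b) := by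
  have hseg : ∀ q ∈ Icc a b, ∀ τ ∈ Ioo (0 : ℝ) 1, z + τ * ((q : ℝ) - z) ∈ D :=
    fun q hq τ hτ => hD.segment_mem z hz q hq τ hτ.1.le hτ.2
  intro q₀ hq₀
  refine continuousWithinAt_of_dominated (bound := fun τ => τ ^ (-lam) * M) ?_ ?_
    ((integrableOn_rpow_neg hlam1).mul_const M) ?_
  · filter_upwards [self_mem_nhdsWithin] with q hq
    exact aestronglyMeasurable_segment hh (hseg q hq) _
  · filter_upwards [self_mem_nhdsWithin] with q hq
    exact ae_restrict_of_forall_mem measurableSet_Ioo fun τ hτ =>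
      norm_rpow_mul_le hτ.1 (hM _ (hseg q hq τ hτ))
  · refine ae_restrict_of_forall_mem measurableSet_Ioo fun τ hτ => ?_
    refine ContinuousAt.continuousWithinAt ?_
    refine continuousAt_const.mul ?_
    refine ContinuousAt.comp (f := fun q : ℝ => z + τ * ((q : ℂ) - z))
      (hh.continuousAt (hD.isOpen.mem_nhds (hseg q₀ hq₀ τ hτ))) ?_
    fun_prop

/-- Differentiation under the integral sign in the endpoint of the segment. -/
theorem hasDerivAt_segInt_endpoint (hlam1 : lam < 1) (hD : StarAboutInterval a b D)
    {h : ℂ → ℂ} (hh : DifferentiableOn ℂ h D) {M : ℝ} (hM : ∀ s ∈ D, ‖h s‖ ≤ M) {z : ℂ}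
    (hz : z ∈ D) {q : ℝ} (hq : q ∈ Ioo a b) :
    IntegrableOn (fun τ : ℝ => ((τ ^ (-lam) : ℝ) : ℂ) * (deriv h (z + τ * (q - z)) * τ)) (Ioo 0 1) ∧
    HasDerivAt (fun q : ℝ => segInt lam h q z)
      (∫ τ in Ioo (0 : ℝ) 1, ((τ ^ (-lam) : ℝ) : ℂ) * (deriv h (z + τ * (q - z)) * τ)) q := by
  obtain ⟨ε, hε, hball⟩ := Metric.nhds_basis_closedBall.mem_iff.1 (Ioo_mem_nhds hq.1 hq.2)
  have hcl : ∀ y ∈ Metric.closedBall q ε, ∀ τ ∈ Icc (0 : ℝ) 1, z + τ * ((y : ℝ) - z) ∈ D := by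
    intro y hy τ hτ
    rcases hτ.2.eq_or_lt with rfl | h1
    · simpa using hD.ofReal_mem y (hball hy)
    · exact hD.segment_mem z hz y (Ioo_subset_Icc_self (hball hy)) τ hτ.1 h1
  have hd : DifferentiableOn ℂ (deriv h) D := hh.deriv hD.isOpen
  -- the derivative of `h` is bounded on the compact union of the segments to nearby endpoints
  obtain ⟨B, hB⟩ := ((isCompact_closedBall q ε).prod (isCompact_Icc (a := (0 : ℝ)) (b := 1))
    ).exists_bound_of_continuousOn (f := fun x : ℝ × ℝ => deriv h (z + x.2 * (x.1 - z)))
    (hd.continuousOn.comp (by fun_prop) fun x hx => hcl x.1 hx.1 x.2 hx.2)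
  have hsegq : ∀ y ∈ Metric.closedBall q ε, ∀ τ ∈ Ioo (0 : ℝ) 1, z + τ * ((y : ℝ) - z) ∈ D :=
    fun y hy τ hτ => hcl y hy τ (Ioo_subset_Icc_self hτ)
  have hqb : q ∈ Metric.closedBall q ε := Metric.mem_closedBall_self hε.le
  refine hasDerivAt_integral_of_dominated_loc_of_deriv_le (μ := volume.restrict (Ioo (0 : ℝ) 1))
    (F := fun (q τ : ℝ) => ((τ ^ (-lam) : ℝ) : ℂ) * h (z + τ * (q - z)))
    (F' := fun (q τ : ℝ) => ((τ ^ (-lam) : ℝ) : ℂ) * (deriv h (z + τ * (q - z)) * τ))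
    (bound := fun τ => τ ^ (-lam) * B) (Metric.closedBall_mem_nhds q hε) ?_ ?_ ?_ ?_ ?_ ?_
  · filter_upwards [Metric.closedBall_mem_nhds q hε] with y hy
    exact aestronglyMeasurable_segment hh.continuousOn (hsegq y hy) _
  · exact integrableOn_segment hlam1 hh.continuousOn (hsegq q hqb) hM
  · have h1 := aestronglyMeasurable_segment hd.continuousOn (hsegq q hqb) (-lam)
    have h2 : AEStronglyMeasurable (fun τ : ℝ => (τ : ℂ)) (volume.restrict (Ioo (0 : ℝ) 1)) :=
      Complex.continuous_ofReal.aestronglyMeasurable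
    exact (h1.mul h2).congr (Eventually.of_forall fun τ => mul_assoc _ _ _)
  · refine ae_restrict_of_forall_mem measurableSet_Ioo fun τ hτ y hy => ?_
    refine norm_rpow_mul_le hτ.1 ?_
    rw [norm_mul, Complex.norm_real, Real.norm_of_nonneg hτ.1.le]
    have h1 := hB (y, τ) ⟨hy, Ioo_subset_Icc_self hτ⟩
    nlinarith [hτ.1, hτ.2, norm_nonneg (deriv h (z + τ * ((y : ℝ) - z)))]
  · exact (integrableOn_rpow_neg hlam1).mul_const B
  · refine ae_restrict_of_forall_mem measurableSet_Ioo fun τ hτ y hy => ?_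
    refine HasDerivAt.const_mul _ ?_
    have h1 : HasDerivAt h (deriv h (z + τ * ((y : ℝ) - z))) (z + τ * ((y : ℝ) - z)) :=
      (hh.differentiableAt (hD.isOpen.mem_nhds (hsegq y hy τ hτ))).hasDerivAt
    have h2 : HasDerivAt (fun y : ℝ => z + τ * ((y : ℂ) - z)) (τ : ℂ) y := by
      simpa using ((((hasDerivAt_id y).ofReal_comp).sub_const z).const_mul (τ : ℂ)).const_add z
    exact h1.comp y h2

/-- Integration by parts in the segment integral; both sides are `∫ d(τ ^ (1 - lam) h)`. -/
theorem segInt_add_deriv_eq (hlam1 : lam < 1) (hD : StarAboutInterval a b D)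
    {h : ℂ → ℂ} (hh : DifferentiableOn ℂ h D) {M : ℝ} (hM : ∀ s ∈ D, ‖h s‖ ≤ M) {z : ℂ}
    (hz : z ∈ D) {q : ℝ} (hq : q ∈ Ioo a b) :
    (1 - lam) * segInt lam h q z + (q - z) *
      (∫ τ in Ioo (0 : ℝ) 1, ((τ ^ (-lam) : ℝ) : ℂ) * (deriv h (z + τ * (q - z)) * τ)) = h q := by
  have hcl : ∀ τ ∈ Icc (0 : ℝ) 1, z + τ * ((q : ℝ) - z) ∈ D := by
    intro τ hτ
    rcases hτ.2.eq_or_lt with rfl | h1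
    · simpa using hD.ofReal_mem q hq
    · exact hD.segment_mem z hz q (Ioo_subset_Icc_self hq) τ hτ.1 h1
  have i1 := (integrableOn_segment hlam1 hh.continuousOn
    (fun τ hτ => hcl τ (Ioo_subset_Icc_self hτ)) hM).const_mul ((1 : ℂ) - lam)
  have i2 := ((hasDerivAt_segInt_endpoint hlam1 hD hh hM hz hq).1).const_mul
    ((q : ℂ) - z)
  have ftc := intervalIntegral.integral_eq_sub_of_hasDerivAt_of_le (a := 0) (b := 1) zero_le_one
    (f := fun τ : ℝ => ((τ ^ (1 - lam) : ℝ) : ℂ) * h (z + τ * (q - z)))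
    (f' := fun τ : ℝ => (1 - lam) * (((τ ^ (-lam) : ℝ) : ℂ) * h (z + τ * (q - z))) +
      (q - z) * (((τ ^ (-lam) : ℝ) : ℂ) * (deriv h (z + τ * (q - z)) * τ))) ?_ ?_ ?_
  · rw [intervalIntegral.integral_of_le zero_le_one, integral_Ioc_eq_integral_Ioo,
      integral_add i1 i2, integral_const_mul, integral_const_mul] at ftc
    rw [segInt, ftc]
    simp [Real.zero_rpow (sub_pos.2 hlam1).ne']
  · refine ContinuousOn.mul ?_ (hh.continuousOn.comp (by fun_prop) hcl)
    refine Complex.continuous_ofReal.comp_continuousOn ?_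
    exact ContinuousOn.rpow_const continuousOn_id fun x hx => Or.inr (sub_pos.2 hlam1).le
  · intro τ hτ
    have h1 : HasDerivAt h (deriv h (z + τ * ((q : ℝ) - z))) (z + τ * ((q : ℝ) - z)) :=
      (hh.differentiableAt (hD.isOpen.mem_nhds (hcl τ (Ioo_subset_Icc_self hτ)))).hasDerivAt
    have h2 : HasDerivAt (fun τ : ℝ => z + τ * ((q : ℂ) - z)) ((q : ℂ) - z) τ := by
      simpa using (((hasDerivAt_id τ).ofReal_comp).mul_const ((q : ℂ) - z)).const_add z
    have h3 := (Real.hasDerivAt_rpow_const (p := 1 - lam) (Or.inl hτ.1.ne')).ofReal_comp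
    have h4 := h3.mul (h1.comp τ h2)
    refine h4.congr_deriv ?_
    rw [show (1 - lam - 1 : ℝ) = -lam by ring]
    have h5 : τ ^ (1 - lam) = τ ^ (-lam) * τ := by
      rw [show 1 - lam = -lam + 1 by ring, Real.rpow_add_one hτ.1.ne']
    rw [h5]
    push_cast
    simp only [Function.comp]
    ring
  · rw [intervalIntegrable_iff_integrableOn_Ioo_of_le zero_le_one]
    exact i1.add i2

end SegInt

/-! ### Moving the singularity to the left endpoint -/

section Endpoint

variable {lam a b : ℝ} {D : Set ℂ}

theorem hasDerivAt_cpow_mul_segInt (hlam1 : lam < 1) (hD : StarAboutInterval a b D)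
    {h : ℂ → ℂ} (hh : DifferentiableOn ℂ h D) {M : ℝ} (hM : ∀ s ∈ D, ‖h s‖ ≤ M) {z : ℂ}
    (hz : z ∈ D) {q : ℝ} (hq : q ∈ Ioo a b) (hqz : (q : ℂ) - z ∈ Complex.slitPlane) :
    HasDerivAt (fun q : ℝ => ((q : ℂ) - z) ^ ((1 - lam : ℝ) : ℂ) * segInt lam h q z)
      (((q : ℂ) - z) ^ ((-lam : ℝ) : ℂ) * h q) q := by
  have h1 : HasDerivAt (fun q : ℝ => (q : ℂ) - z) 1 q := by
    simpa using ((hasDerivAt_id q).ofReal_comp).sub_const z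
  have h2 : HasDerivAt (fun w : ℂ => w ^ ((1 - lam : ℝ) : ℂ))
      (((1 - lam : ℝ) : ℂ) * ((q : ℂ) - z) ^ (((1 - lam : ℝ) : ℂ) - 1) * 1) ((q : ℂ) - z) :=
    (hasDerivAt_id ((q : ℂ) - z)).cpow_const hqz
  have h3 := (h2.comp q h1).mul (hasDerivAt_segInt_endpoint hlam1 hD hh hM hz hq).2
  refine h3.congr_deriv ?_
  have hne : (q : ℂ) - z ≠ 0 := Complex.slitPlane_ne_zero hqz
  have e1 : ((1 - lam : ℝ) : ℂ) - 1 = ((-lam : ℝ) : ℂ) := by push_cast; ring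
  have e2 : ((q : ℂ) - z) ^ ((1 - lam : ℝ) : ℂ) = ((q : ℂ) - z) ^ ((-lam : ℝ) : ℂ) * (q - z) := by
    rw [show ((1 - lam : ℝ) : ℂ) = ((-lam : ℝ) : ℂ) + 1 by push_cast; ring, Complex.cpow_add _ _ hne,
      Complex.cpow_one]
  have e3 := segInt_add_deriv_eq hlam1 hD hh hM hz hq
  simp only [Function.comp]
  rw [e1, e2, ← e3]
  push_cast
  ring

theorem continuousOn_cpow_sub (z : ℂ) (r : ℂ) {s : Set ℝ}
    (hs : ∀ q ∈ s, (q : ℂ) - z ∈ Complex.slitPlane) :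
    ContinuousOn (fun q : ℝ => ((q : ℂ) - z) ^ r) s :=
  ContinuousOn.cpow_const (by fun_prop) hs

theorem intervalIntegrable_cpow_sub_mul (hlam0 : 0 < lam) {z : ℂ} {h : ℂ → ℂ}
    (hh : ContinuousOn h D) (hIoo : ∀ x ∈ Ioo a b, ((x : ℝ) : ℂ) ∈ D)
    {M : ℝ} (hM : ∀ s ∈ D, ‖h s‖ ≤ M) {p : ℝ} (hp : p ∈ Ioo a b) (hzp : z.re < p) :
    IntervalIntegrable (fun s : ℝ => ((s : ℂ) - z) ^ ((-lam : ℝ) : ℂ) * h s) volume p b := by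
  rw [intervalIntegrable_iff_integrableOn_Ioo_of_le hp.2.le]
  have hsub : ∀ s ∈ Ioo p b, s ∈ Ioo a b := fun s hs => ⟨hp.1.trans hs.1, hs.2⟩
  refine Integrable.mono' (integrable_const ((p - z.re) ^ (-lam) * M)) ?_ ?_
  · refine ContinuousOn.aestronglyMeasurable ?_ measurableSet_Ioo
    refine ContinuousOn.mul ?_ ?_
    · refine continuousOn_cpow_sub z _ fun q hq => Or.inl ?_
      simpa using hzp.trans hq.1
    · exact hh.comp (by fun_prop) fun s hs => hIoo s (hsub s hs)
  · refine ae_restrict_of_forall_mem measurableSet_Ioo fun s hs => ?_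
    have h1 : p - z.re ≤ ‖(s : ℂ) - z‖ := by
      refine le_trans ?_ (Complex.re_le_norm _)
      simpa using hs.1.le
    rw [norm_mul, Complex.norm_cpow_real]
    refine mul_le_mul ?_ (hM _ (hIoo s (hsub s hs))) (norm_nonneg _)
      (Real.rpow_nonneg (sub_pos.2 hzp).le _)
    exact Real.rpow_le_rpow_of_nonpos (sub_pos.2 hzp) h1 (by linarith)

/-- Deformation of the segment from `z` to `b` into the broken line from `z` through `p` to `b`:
by `hasDerivAt_cpow_mul_segInt` this is the fundamental theorem of calculus in the endpoint. -/
theorem integral_cpow_sub_mul_eq (hlam0 : 0 < lam) (hlam1 : lam < 1) (hD : StarAboutInterval a b D)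
    {h : ℂ → ℂ} (hh : DifferentiableOn ℂ h D) {M : ℝ} (hM : ∀ s ∈ D, ‖h s‖ ≤ M) {z : ℂ}
    (hz : z ∈ D) {p : ℝ} (hp : p ∈ Ioo a b) (hzp : z.re < p) :
    ∫ s in p..b, ((s : ℂ) - z) ^ ((-lam : ℝ) : ℂ) * h s =
      ((b : ℂ) - z) ^ ((1 - lam : ℝ) : ℂ) * segInt lam h b z -
      ((p : ℂ) - z) ^ ((1 - lam : ℝ) : ℂ) * segInt lam h p z := by
  have hslit : ∀ q : ℝ, p ≤ q → (q : ℂ) - z ∈ Complex.slitPlane := fun q hq => Or.inl (by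
    simpa using hzp.trans_le hq)
  refine intervalIntegral.integral_eq_sub_of_hasDerivAt_of_le hp.2.le
    (f := fun q : ℝ => ((q : ℂ) - z) ^ ((1 - lam : ℝ) : ℂ) * segInt lam h q z) ?_ ?_
    (intervalIntegrable_cpow_sub_mul hlam0 hh.continuousOn hD.ofReal_mem hM hp hzp)
  · refine (continuousOn_cpow_sub z _ fun q hq => hslit q hq.1).mul ?_
    exact (continuousOn_segInt_endpoint hlam1 hD hh.continuousOn hM hz).mono
      (Icc_subset_Icc_left hp.1.le)
  · intro q hq
    exact hasDerivAt_cpow_mul_segInt hlam1 hD hh hM hz ⟨hp.1.trans hq.1, hq.2⟩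
      (hslit q hq.1.le)

/-- Moving the singularity from `a` to `z` changes the kernel little at distance `2 * ‖z - a‖`. -/
theorem norm_cpow_sub_sub_cpow_le (hlam0 : 0 < lam) {z : ℂ} {s : ℝ} (hs : 2 * ‖z - a‖ < s - a)
    (hsa : 0 < s - a) :
    ‖((s : ℂ) - z) ^ ((-lam : ℝ) : ℂ) - ((s : ℂ) - a) ^ ((-lam : ℝ) : ℂ)‖ ≤
      lam * ((s - a) / 2) ^ (-lam - 1) * ‖z - a‖ := by
  set S := Metric.ball ((s : ℂ) - a) ((s - a) / 2) with hS
  have hre : ∀ w ∈ S, (s - a) / 2 ≤ w.re := by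
    intro w hw
    rw [hS, Metric.mem_ball, dist_eq_norm] at hw
    have h1 := (abs_le.1 ((Complex.abs_re_le_norm _).trans hw.le)).1
    simp only [Complex.sub_re, Complex.ofReal_re] at h1
    linarith
  have hder : ∀ w ∈ S, HasDerivAt (fun w : ℂ => w ^ ((-lam : ℝ) : ℂ))
      (((-lam : ℝ) : ℂ) * w ^ (((-lam : ℝ) : ℂ) - 1) * 1) w := fun w hw =>
    (hasDerivAt_id w).cpow_const (Or.inl ((show 0 < (s - a) / 2 by linarith).trans_le (hre w hw)))
  have hbd : ∀ w ∈ S, ‖((-lam : ℝ) : ℂ) * w ^ (((-lam : ℝ) : ℂ) - 1) * 1‖ ≤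
      lam * ((s - a) / 2) ^ (-lam - 1) := by
    intro w hw
    rw [mul_one, norm_mul, show ((-lam : ℝ) : ℂ) - 1 = ((-lam - 1 : ℝ) : ℂ) by push_cast; ring,
      Complex.norm_cpow_real, Complex.norm_real, norm_neg, Real.norm_of_nonneg hlam0.le]
    gcongr lam * ?_
    exact Real.rpow_le_rpow_of_nonpos (by linarith)
      ((hre w hw).trans (Complex.re_le_norm w)) (by linarith)
  have h2 := (convex_ball ((s : ℂ) - a) ((s - a) / 2)).norm_image_sub_le_of_norm_hasDerivWithin_le
    (fun w hw => (hder w hw).hasDerivWithinAt) hbd (x := (s : ℂ) - a) (y := (s : ℂ) - z)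
    (Metric.mem_ball_self (by linarith))
    (by
      rw [Metric.mem_ball, dist_eq_norm, show (s : ℂ) - z - (s - a) = -(z - a) by ring, norm_neg]
      linarith)
  rwa [show (s : ℂ) - z - (s - a) = -(z - a) by ring, norm_neg] at h2

theorem intervalIntegrable_sub_rpow (hlam1 : lam < 1) (x y : ℝ) :
    IntervalIntegrable (fun s : ℝ => (s - a) ^ (-lam)) volume x y := by
  have := (intervalIntegral.intervalIntegrable_rpow' (a := x - a) (b := y - a) (r := -lam)
    (by linarith)).comp_sub_right a
  simpa using this

/-- Let `h` be bounded by `M` and holomorphic. The weakly singular integral of `h` with the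
singularity at `z` differs by `O(‖z - a‖ ^ (1 - lam))` from the one with the singularity at `a`:
pass through the real point `p = a + 2 * ‖z - a‖`. -/
theorem norm_cpow_mul_segInt_sub_le (hlam0 : 0 < lam) (hlam1 : lam < 1) (hD : StarAboutInterval a b D)
    {h : ℂ → ℂ} (hh : DifferentiableOn ℂ h D) {M : ℝ} (hM : ∀ s ∈ D, ‖h s‖ ≤ M) {z : ℂ}
    (hz : z ∈ D) (hza : z ≠ a) (hzb : 2 * ‖z - a‖ < b - a) :
    ‖((b : ℂ) - z) ^ ((1 - lam : ℝ) : ℂ) * segInt lam h b z -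
      ∫ s in a..b, ((|a - s| ^ (-lam) : ℝ) : ℂ) * h s‖ ≤
      M * (5 / (1 - lam) + 2) * ‖z - a‖ ^ (1 - lam) := by
  set ρ := ‖z - a‖ with hρ
  have hρ0 : 0 < ρ := norm_pos_iff.2 (sub_ne_zero.2 hza)
  have hM0 : 0 ≤ M := (norm_nonneg _).trans (hM z hz)
  have hl : 0 < 1 - lam := sub_pos.2 hlam1
  set p := a + 2 * ρ with hpdef
  have hp : p ∈ Ioo a b := ⟨by linarith, by linarith⟩
  have hzre : z.re < p := by
    have h1 := (Complex.re_le_norm (z - a))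
    simp only [Complex.sub_re, Complex.ofReal_re] at h1
    linarith
  have hdef := integral_cpow_sub_mul_eq hlam0 hlam1 hD hh hM hz hp hzre
  -- the integral with singularity at `a` is split at `p`
  have hwt : ∀ s ∈ Ioo a b, ‖((|a - s| ^ (-lam) : ℝ) : ℂ) * h s‖ ≤ (s - a) ^ (-lam) * M := by
    intro s hs
    rw [abs_sub_comm, abs_of_pos (sub_pos.2 hs.1)]
    exact norm_rpow_mul_le (sub_pos.2 hs.1) (hM _ (hD.ofReal_mem s hs))
  have hint : IntegrableOn (fun s : ℝ => ((|a - s| ^ (-lam) : ℝ) : ℂ) * h s) (Ioo a b) := 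
    integrableOn_abs_sub_rpow_mul hlam1 (hp.1.trans hp.2).le hD.ofReal_mem hh.continuousOn hM a
  have hint1 : IntervalIntegrable (fun s : ℝ => ((|a - s| ^ (-lam) : ℝ) : ℂ) * h s) volume a p := by
    rw [intervalIntegrable_iff_integrableOn_Ioo_of_le hp.1.le]
    exact hint.mono_set (Ioo_subset_Ioo_right hp.2.le)
  have hint2 : IntervalIntegrable (fun s : ℝ => ((|a - s| ^ (-lam) : ℝ) : ℂ) * h s) volume p b := by
    rw [intervalIntegrable_iff_integrableOn_Ioo_of_le hp.2.le]
    exact hint.mono_set (Ioo_subset_Ioo_left hp.1.le)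
  have hint3 := intervalIntegrable_cpow_sub_mul hlam0 hh.continuousOn hD.ofReal_mem hM hp hzre
  rw [← intervalIntegral.integral_add_adjacent_intervals hint1 hint2,
    show ((b : ℂ) - z) ^ ((1 - lam : ℝ) : ℂ) * segInt lam h b z =
      ((p : ℂ) - z) ^ ((1 - lam : ℝ) : ℂ) * segInt lam h p z +
      ∫ s in p..b, ((s : ℂ) - z) ^ ((-lam : ℝ) : ℂ) * h s by rw [hdef]; ring]
  -- the three pieces: from `z` to `p`, from `a` to `p`, and the difference from `p` to `b`
  have hT1 : ‖((p : ℂ) - z) ^ ((1 - lam : ℝ) : ℂ) * segInt lam h p z‖ ≤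
      3 * ρ ^ (1 - lam) * (M / (1 - lam)) := by
    rw [norm_mul, Complex.norm_cpow_real]
    refine mul_le_mul ?_ (norm_segInt_le hlam1 fun τ hτ => hM _
      (hD.segment_mem z hz p (Ioo_subset_Icc_self hp) τ hτ.1.le hτ.2)) (norm_nonneg _) (by positivity)
    have h1 : ‖(p : ℂ) - z‖ ≤ 3 * ρ := by
      have h2 : (p : ℂ) - z = ((2 * ρ : ℝ) : ℂ) - (z - a) := by rw [hpdef]; push_cast; ring
      rw [h2]
      refine (norm_sub_le _ _).trans ?_
      rw [Complex.norm_real, Real.norm_of_nonneg (by positivity), ← hρ]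
      linarith
    calc ‖(p : ℂ) - z‖ ^ (1 - lam) ≤ (3 * ρ) ^ (1 - lam) := by gcongr
      _ = 3 ^ (1 - lam) * ρ ^ (1 - lam) := Real.mul_rpow (by norm_num) hρ0.le
      _ ≤ 3 * ρ ^ (1 - lam) := by
        gcongr
        exact Real.rpow_le_self_of_one_le (by norm_num) (by linarith)
  have hpow2 : (2 * ρ) ^ (1 - lam) ≤ 2 * ρ ^ (1 - lam) := by
    rw [Real.mul_rpow (by norm_num) hρ0.le]
    gcongr
    exact Real.rpow_le_self_of_one_le (by norm_num) (by linarith)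
  have hT2 : ‖∫ s in a..p, ((|a - s| ^ (-lam) : ℝ) : ℂ) * h s‖ ≤
      2 * ρ ^ (1 - lam) / (1 - lam) * M := by
    have h1 := intervalIntegral.norm_integral_le_of_norm_le (μ := volume)
      (f := fun s : ℝ => ((|a - s| ^ (-lam) : ℝ) : ℂ) * h s)
      (g := fun s : ℝ => (s - a) ^ (-lam) * M) hp.1.le
      (Eventually.of_forall fun s hs => hwt s ⟨hs.1, hs.2.trans_lt hp.2⟩)
      ((intervalIntegrable_sub_rpow hlam1 a p).mul_const M)
    rw [intervalIntegral.integral_mul_const, intervalIntegral.integral_comp_sub_right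
      (fun s => s ^ (-lam)), integral_rpow (Or.inl (by linarith)), sub_self,
      Real.zero_rpow (by linarith), sub_zero, show -lam + 1 = 1 - lam by ring,
      show p - a = 2 * ρ by rw [hpdef]; ring] at h1
    refine h1.trans ?_
    gcongr
  have hT3 : ‖(∫ s in p..b, ((s : ℂ) - z) ^ ((-lam : ℝ) : ℂ) * h s) -
      ∫ s in p..b, ((|a - s| ^ (-lam) : ℝ) : ℂ) * h s‖ ≤ 2 * ρ ^ (1 - lam) * M := by
    rw [← intervalIntegral.integral_sub hint3 hint2]
    have hpa : 0 < (p - a) / 2 := by linarith [hp.1]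
    have hpi : IntervalIntegrable (fun s : ℝ => ((s - a) / 2) ^ (-lam - 1)) volume p b := by
      refine ContinuousOn.intervalIntegrable ?_
      rw [uIcc_of_le hp.2.le]
      exact ContinuousOn.rpow_const (by fun_prop) fun s hs => Or.inl
        (by linarith [hs.1] : 0 < (s - a) / 2).ne'
    have h1 := intervalIntegral.norm_integral_le_of_norm_le (μ := volume)
      (f := fun s : ℝ => ((s : ℂ) - z) ^ ((-lam : ℝ) : ℂ) * h s -
        ((|a - s| ^ (-lam) : ℝ) : ℂ) * h s)
      (g := fun s : ℝ => ((s - a) / 2) ^ (-lam - 1) * (lam * ρ * M)) hp.2.le ?_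
      (hpi.mul_const _)
    · have h2 : ∫ s in p..b, ((s - a) / 2) ^ (-lam - 1) ≤ 2 * ρ ^ (-lam) / lam := by
        have h3 : ∀ s ∈ uIcc p b, HasDerivAt
            (fun s : ℝ => -(2 / lam) * ((s - a) / 2) ^ (-lam)) (((s - a) / 2) ^ (-lam - 1)) s := by
          intro s hs
          rw [uIcc_of_le hp.2.le] at hs
          have h4 : 0 < (s - a) / 2 := by linarith [hs.1]
          have h5 : HasDerivAt (fun s : ℝ => (s - a) / 2) (1 / 2) s :=
            ((hasDerivAt_id s).sub_const a).div_const 2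
          refine ((h5.rpow_const (p := -lam) (Or.inl h4.ne')).const_mul (-(2 / lam))).congr_deriv ?_
          field_simp
        rw [intervalIntegral.integral_eq_sub_of_hasDerivAt h3 hpi,
          show (p - a) / 2 = ρ by rw [hpdef]; ring]
        have h6 : 0 ≤ 2 / lam * ((b - a) / 2) ^ (-lam) := by
          have : 0 ≤ (b - a) / 2 := by linarith
          positivity
        have h7 : 2 * ρ ^ (-lam) / lam = 2 / lam * ρ ^ (-lam) := by ring
        rw [h7]
        linarith
      rw [intervalIntegral.integral_mul_const] at h1
      refine h1.trans ?_
      calc _ ≤ 2 * ρ ^ (-lam) / lam * (lam * ρ * M) := by gcongr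
        _ = 2 * (ρ ^ (-lam) * ρ) * M := by field_simp
        _ = 2 * ρ ^ (1 - lam) * M := by
          rw [← Real.rpow_add_one hρ0.ne', show -lam + 1 = 1 - lam by ring]
    · filter_upwards [compl_mem_ae_iff.2 (measure_singleton b)] with s hne hs
      have hsb : s < b := hs.2.lt_of_ne hne
      have hsa : 0 < s - a := by linarith [hs.1]
      have h2 : ((|a - s| ^ (-lam) : ℝ) : ℂ) = ((s : ℂ) - a) ^ ((-lam : ℝ) : ℂ) := by
        rw [abs_sub_comm, abs_of_pos hsa, Complex.ofReal_cpow hsa.le]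
        push_cast
        rfl
      rw [h2, ← sub_mul, norm_mul]
      have h3 := norm_cpow_sub_sub_cpow_le hlam0 (a := a) (z := z) (s := s)
        (by linarith [hs.1]) hsa
      calc _ ≤ lam * ((s - a) / 2) ^ (-lam - 1) * ‖z - a‖ * M := by
            refine mul_le_mul h3 (hM _ (hD.ofReal_mem s ⟨hp.1.trans hs.1, hsb⟩)) (norm_nonneg _) ?_
            exact (norm_nonneg _).trans h3
        _ = _ := by ring
  have htri := norm_add₃_le (a := ((p : ℂ) - z) ^ ((1 - lam : ℝ) : ℂ) * segInt lam h p z)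
    (b := -∫ s in a..p, ((|a - s| ^ (-lam) : ℝ) : ℂ) * h s)
    (c := (∫ s in p..b, ((s : ℂ) - z) ^ ((-lam : ℝ) : ℂ) * h s) -
      ∫ s in p..b, ((|a - s| ^ (-lam) : ℝ) : ℂ) * h s)
  rw [norm_neg] at htri
  refine le_trans (le_of_eq (congrArg norm ?_)) (htri.trans ((add_le_add_three hT1 hT2 hT3).trans
    (le_of_eq ?_)))
  · ring
  · field_simp
    ring

end Endpoint

/-! ### Holomorphic extension of the singular integral -/

/-- The holomorphic extension to `D` of `t ↦ ∫ s in a..b, |t - s| ^ (-lam) * K t s`: for real `t`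
the integral is split at `t`, and for complex `z` both parts are taken along segments from `z`, with
principal branches of the powers. -/
noncomputable def singularExt (lam a b : ℝ) (K : ℂ → ℂ → ℂ) (z : ℂ) : ℂ :=
  ((b : ℂ) - z) ^ ((1 - lam : ℝ) : ℂ) * segInt lam (K z) b z +
    (z - a) ^ ((1 - lam : ℝ) : ℂ) * segInt lam (K z) a z

section Extension

variable {lam a b : ℝ} {D : Set ℂ}

theorem StarAboutInterval.segment_mem_Ioo (hD : StarAboutInterval a b D) {p : ℝ} (hp : p ∈ Icc a b)
    {z : ℂ} (hz : z ∈ D) {τ : ℝ} (hτ : τ ∈ Ioo (0 : ℝ) 1) : z + τ * ((p : ℂ) - z) ∈ D :=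
  hD.segment_mem z hz p hp τ hτ.1.le hτ.2

theorem differentiableOn_singularExt (hlam1 : lam < 1) (hab : a ≤ b)
    (hD : StarAboutInterval a b D) (hslitb : ∀ z ∈ D, (b : ℂ) - z ∈ Complex.slitPlane)
    (hslita : ∀ z ∈ D, z - a ∈ Complex.slitPlane) {K : ℂ → ℂ → ℂ} {M : ℝ}
    (hM : ∀ z ∈ D, ∀ s ∈ D, ‖K z s‖ ≤ M)
    (h1 : ∀ s ∈ D, DifferentiableOn ℂ (fun z => K z s) D)
    (h2 : ∀ z ∈ D, DifferentiableOn ℂ (K z) D) :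
    DifferentiableOn ℂ (singularExt lam a b K) D := by
  have hb := differentiableOn_segInt hlam1 hD.isOpen (q := (b : ℂ))
    (fun z hz τ hτ => hD.segment_mem_Ioo ⟨hab, le_rfl⟩ hz hτ) hM h1 h2
  have ha := differentiableOn_segInt hlam1 hD.isOpen (q := (a : ℂ))
    (fun z hz τ hτ => hD.segment_mem_Ioo ⟨le_rfl, hab⟩ hz hτ) hM h1 h2
  have hpb : DifferentiableOn ℂ (fun z : ℂ => ((b : ℂ) - z) ^ ((1 - lam : ℝ) : ℂ)) D :=
    DifferentiableOn.cpow_const (by fun_prop) hslitb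
  have hpa : DifferentiableOn ℂ (fun z : ℂ => (z - a) ^ ((1 - lam : ℝ) : ℂ)) D :=
    DifferentiableOn.cpow_const (by fun_prop) hslita
  exact (hpb.mul hb).add (hpa.mul ha)

theorem singularExt_ofReal (hlam1 : lam < 1) (hD : StarAboutInterval a b D) {K : ℂ → ℂ → ℂ} {M : ℝ}
    {t : ℝ} (ht : t ∈ Ioo a b) (hM : ∀ s ∈ D, ‖K t s‖ ≤ M) (hK : ContinuousOn (K t) D) :
    singularExt lam a b K t = ∫ s in a..b, ((|t - s| ^ (-lam) : ℝ) : ℂ) * K t s := by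
  have hint := integrableOn_abs_sub_rpow_mul hlam1 (ht.1.trans ht.2).le hD.ofReal_mem hK hM t
  have hint1 : IntervalIntegrable (fun s : ℝ => ((|t - s| ^ (-lam) : ℝ) : ℂ) * K t s)
      volume a t := by
    rw [intervalIntegrable_iff_integrableOn_Ioo_of_le ht.1.le]
    exact hint.mono_set (Ioo_subset_Ioo_right ht.2.le)
  have hint2 : IntervalIntegrable (fun s : ℝ => ((|t - s| ^ (-lam) : ℝ) : ℂ) * K t s)
      volume t b := by
    rw [intervalIntegrable_iff_integrableOn_Ioo_of_le ht.2.le]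
    exact hint.mono_set (Ioo_subset_Ioo_left ht.1.le)
  have hpow : ∀ {x : ℝ}, 0 < x → x * x ^ (-lam) = x ^ (1 - lam) := fun {x} hx => by
    rw [mul_comm, ← Real.rpow_add_one hx.ne', show -lam + 1 = 1 - lam by ring]
  have hta := sub_pos.2 ht.1
  have htb := sub_pos.2 ht.2
  rw [← intervalIntegral.integral_add_adjacent_intervals hint1 hint2,
    intervalIntegral.integral_symm, integral_abs_sub_rpow_mul_eq, integral_abs_sub_rpow_mul_eq,
    singularExt, abs_of_pos htb, hpow htb, abs_sub_comm a t, abs_of_pos hta,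
    show (a - t) * (t - a) ^ (-lam) = -(t - a) ^ (1 - lam) by rw [← hpow hta]; ring,
    Complex.ofReal_neg, Complex.ofReal_cpow hta.le, Complex.ofReal_cpow htb.le,
    Complex.ofReal_sub t a, Complex.ofReal_sub b t]
  ring

theorem singularExt_reflect (K : ℂ → ℂ → ℂ) (z : ℂ) :
    singularExt lam a b (fun z s => K (a + b - z) (a + b - s)) z =
      singularExt lam a b K (a + b - z) := by
  simp only [singularExt, segInt]
  rw [show (a : ℂ) + b - z - a = b - z by ring, show (b : ℂ) - (a + b - z) = z - a by ring, add_comm]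
  congr 4 <;> ext τ <;> ring_nf

/-- The Hölder estimate for the extension at the left endpoint. -/
theorem exists_norm_singularExt_sub_left_le (hlam0 : 0 < lam) (hlam1 : lam < 1) (hab : a < b)
    (hD : StarAboutInterval a b D) (haD : (a : ℂ) ∉ D) {K : ℂ → ℂ → ℂ} {M L : ℝ}
    (hM : ∀ z ∈ insert (a : ℂ) D, ∀ s ∈ D, ‖K z s‖ ≤ M)
    (hK : ∀ z ∈ insert (a : ℂ) D, DifferentiableOn ℂ (K z) D)
    (hL : ∀ z ∈ D, ∀ s ∈ D, ‖K z s - K a s‖ ≤ L * ‖z - a‖ ^ (1 - lam)) :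
    ∃ C : ℝ, ∀ z ∈ D, 2 * ‖z - a‖ < b - a →
      ‖singularExt lam a b K z - ∫ s in a..b, ((|a - s| ^ (-lam) : ℝ) : ℂ) * K a s‖ ≤
        C * ‖z - a‖ ^ (1 - lam) := by
  have hl := sub_pos.2 hlam1
  refine ⟨(2 * (b - a)) ^ (1 - lam) * (L / (1 - lam)) + M * (5 / (1 - lam) + 2) + M / (1 - lam),
    fun z hz hzb => ?_⟩
  have haI : (a : ℂ) ∈ insert (a : ℂ) D := mem_insert _ _
  have hzI : z ∈ insert (a : ℂ) D := mem_insert_of_mem _ hz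
  have hsegb : ∀ τ ∈ Ioo (0 : ℝ) 1, z + τ * ((b : ℂ) - z) ∈ D := fun τ hτ =>
    hD.segment_mem_Ioo ⟨hab.le, le_rfl⟩ hz hτ
  have hsega : ∀ τ ∈ Ioo (0 : ℝ) 1, z + τ * ((a : ℂ) - z) ∈ D := fun τ hτ =>
    hD.segment_mem_Ioo ⟨le_rfl, hab.le⟩ hz hτ
  have hdiff : segInt lam (K z) b z - segInt lam (K a) b z =
      segInt lam (fun s => K z s - K a s) b z := by
    rw [segInt, segInt, segInt, ← integral_sub
      (integrableOn_segment hlam1 (hK z hzI).continuousOn hsegb (hM z hzI))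
      (integrableOn_segment hlam1 (hK a haI).continuousOn hsegb (hM a haI))]
    simp only [mul_sub]
  have hLz : 0 ≤ L * ‖z - a‖ ^ (1 - lam) := (norm_nonneg _).trans (hL z hz z hz)
  have hbz : ‖(b : ℂ) - z‖ ≤ 2 * (b - a) := by
    rw [show (b : ℂ) - z = ((b - a : ℝ) : ℂ) - (z - a) by push_cast; ring]
    refine (norm_sub_le _ _).trans ?_
    rw [Complex.norm_real, Real.norm_of_nonneg (sub_pos.2 hab).le]
    linarith
  have hT1 : ‖((b : ℂ) - z) ^ ((1 - lam : ℝ) : ℂ) *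
      (segInt lam (K z) b z - segInt lam (K a) b z)‖ ≤
      (2 * (b - a)) ^ (1 - lam) * (L * ‖z - a‖ ^ (1 - lam) / (1 - lam)) := by
    rw [hdiff, norm_mul, Complex.norm_cpow_real]
    refine mul_le_mul (by gcongr) (norm_segInt_le hlam1 fun τ hτ => hL z hz _ (hsegb τ hτ))
      (norm_nonneg _) (Real.rpow_nonneg (by linarith) _)
  have hT2 := norm_cpow_mul_segInt_sub_le hlam0 hlam1 hD (hK a haI) (hM a haI) hz
    (fun h => haD (h ▸ hz)) hzb
  have hT3 : ‖(z - a) ^ ((1 - lam : ℝ) : ℂ) * segInt lam (K z) a z‖ ≤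
      ‖z - a‖ ^ (1 - lam) * (M / (1 - lam)) := by
    rw [norm_mul, Complex.norm_cpow_real]
    gcongr
    exact norm_segInt_le hlam1 fun τ hτ => hM z hzI _ (hsega τ hτ)
  have htri := norm_add₃_le (a := ((b : ℂ) - z) ^ ((1 - lam : ℝ) : ℂ) *
      (segInt lam (K z) b z - segInt lam (K a) b z))
    (b := ((b : ℂ) - z) ^ ((1 - lam : ℝ) : ℂ) * segInt lam (K a) b z -
      ∫ s in a..b, ((|a - s| ^ (-lam) : ℝ) : ℂ) * K a s)
    (c := (z - a) ^ ((1 - lam : ℝ) : ℂ) * segInt lam (K z) a z)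
  refine le_trans (le_of_eq (congrArg norm ?_)) (htri.trans ((add_le_add_three hT1 hT2 hT3).trans
    (le_of_eq ?_)))
  · rw [singularExt]; ring
  · ring

/-- The Hölder estimate for the extension at the right endpoint, by reflection. -/
theorem exists_norm_singularExt_sub_right_le (hlam0 : 0 < lam) (hlam1 : lam < 1) (hab : a < b)
    (hD : StarAboutInterval a b D) (hrefl : ∀ z ∈ D, (a : ℂ) + b - z ∈ D) (hbD : (b : ℂ) ∉ D)
    {K : ℂ → ℂ → ℂ} {M L : ℝ}
    (hM : ∀ z ∈ insert (b : ℂ) D, ∀ s ∈ D, ‖K z s‖ ≤ M)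
    (hK : ∀ z ∈ insert (b : ℂ) D, DifferentiableOn ℂ (K z) D)
    (hL : ∀ z ∈ D, ∀ s ∈ D, ‖K z s - K b s‖ ≤ L * ‖z - b‖ ^ (1 - lam)) :
    ∃ C : ℝ, ∀ z ∈ D, 2 * ‖z - b‖ < b - a →
      ‖singularExt lam a b K z - ∫ s in a..b, ((|b - s| ^ (-lam) : ℝ) : ℂ) * K b s‖ ≤
        C * ‖z - b‖ ^ (1 - lam) := by
  have hins : ∀ z ∈ insert (a : ℂ) D, (a : ℂ) + b - z ∈ insert (b : ℂ) D := by
    rintro z (rfl | hz)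
    · exact Or.inl (by ring)
    · exact Or.inr (hrefl z hz)
  have hnorm : ∀ z : ℂ, ‖(a : ℂ) + b - z - b‖ = ‖z - a‖ := fun z => by
    rw [show (a : ℂ) + b - z - b = -(z - a) by ring, norm_neg]
  have hnorm' : ∀ z : ℂ, ‖(a : ℂ) + b - z - a‖ = ‖z - b‖ := fun z => by
    rw [show (a : ℂ) + b - z - a = -(z - b) by ring, norm_neg]
  have haD : (a : ℂ) ∉ D := fun h => hbD (by simpa using hrefl _ h)
  obtain ⟨C, hC⟩ := exists_norm_singularExt_sub_left_le hlam0 hlam1 hab hD haD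
    (K := fun z s => K (a + b - z) (a + b - s)) (M := M) (L := L)
    (fun z hz s hs => hM _ (hins z hz) _ (hrefl s hs))
    (fun z hz => (hK _ (hins z hz)).comp (by fun_prop) hrefl)
    (fun z hz s hs => by
      have := hL _ (hrefl z hz) _ (hrefl s hs)
      rw [hnorm] at this
      simpa only [add_sub_cancel_left] using this)
  refine ⟨C, fun z hz hzb => ?_⟩
  have h1 := hC _ (hrefl z hz) (by rwa [hnorm'])
  have h2 : ∫ s in a..b, ((|a - s| ^ (-lam) : ℝ) : ℂ) * K (a + b - a) (a + b - s) =
      ∫ s in a..b, ((|b - s| ^ (-lam) : ℝ) : ℂ) * K b s := by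
    have h3 := intervalIntegral.integral_comp_sub_left (a := a) (b := b)
      (fun s : ℝ => ((|b - s| ^ (-lam) : ℝ) : ℂ) * K b s) (a + b)
    rw [add_sub_cancel_right, add_sub_cancel_left] at h3
    rw [← h3]
    refine intervalIntegral.integral_congr fun s _ => ?_
    rw [show b - (a + b - s) = -(a - s) by ring, abs_neg, add_sub_cancel_left]
    push_cast
    rfl
  rwa [singularExt_reflect, h2, hnorm', sub_sub_cancel] at h1

end Extension

/-! ### Hölder estimates at the endpoints and the classes `L` and `M` -/

section EndpointClasses

variable {a b : ℝ} {D : Set ℂ} {f : ℂ → ℂ}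

theorem rpow_le_mul_rpow {x A α γ : ℝ} (hx : 0 ≤ x) (hxA : x ≤ A) (hγ : 0 < γ) (hγα : γ ≤ α) :
    x ^ α ≤ A ^ (α - γ) * x ^ γ := by
  have h1 : x ^ α = x ^ (α - γ) * x ^ γ := by
    rw [← Real.rpow_add_of_nonneg hx (by linarith) hγ.le, sub_add_cancel]
  rw [h1]
  have := sub_nonneg.2 hγα
  gcongr

theorem norm_endpointQ_rpow (a b α : ℝ) (z : ℂ) :
    ‖endpointQ a b z‖ ^ α = ‖z - a‖ ^ α * ‖(b : ℂ) - z‖ ^ α := by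
  rw [endpointQ, norm_mul, Real.mul_rpow (norm_nonneg _) (norm_nonneg _)]

theorem sub_left_eq_endpointG (hab : a < b) (f : ℂ → ℂ) (z : ℂ) :
    f z - f a = endpointG a b f z + (z - a) / (b - a) * (f b - f a) := by
  have hab' : (b : ℂ) - a ≠ 0 := by rw [sub_ne_zero]; exact_mod_cast hab.ne'
  rw [endpointG]
  field_simp
  ring

theorem sub_right_eq_endpointG (hab : a < b) (f : ℂ → ℂ) (z : ℂ) :
    f z - f b = endpointG a b f z + (b - z) / (b - a) * (f a - f b) := by
  have hab' : (b : ℂ) - a ≠ 0 := by rw [sub_ne_zero]; exact_mod_cast hab.ne'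
  rw [endpointG]
  field_simp
  ring

theorem norm_div_sub_mul_le (hab : a < b) {w y : ℂ} {A B γ : ℝ} (hw : ‖w‖ ≤ A) (hy : ‖y‖ ≤ B)
    (hγ0 : 0 < γ) (hγ1 : γ ≤ 1) :
    ‖w / ((b : ℂ) - a) * y‖ ≤ A ^ (1 - γ) * B / (b - a) * ‖w‖ ^ γ := by
  have hba := sub_pos.2 hab
  have h1 := rpow_le_mul_rpow (norm_nonneg w) hw hγ0 hγ1
  rw [Real.rpow_one] at h1
  rw [norm_mul, norm_div, ← Complex.ofReal_sub, Complex.norm_real, Real.norm_of_nonneg hba.le]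
  have hA : 0 ≤ A ^ (1 - γ) * ‖w‖ ^ γ := (norm_nonneg _).trans h1
  calc ‖w‖ / (b - a) * ‖y‖ ≤ A ^ (1 - γ) * ‖w‖ ^ γ / (b - a) * B := by gcongr
    _ = _ := by ring

/-- A bound on `endpointG a b f` by a power of `endpointQ a b` gives Hölder estimates at `a` and
`b`. The constant depends on `f` only through the given bounds. -/
theorem norm_sub_endpoint_le (hab : a < b) {α γ C A B : ℝ} (hC : 0 ≤ C) (hγ0 : 0 < γ) (hγ1 : γ ≤ 1)
    (hγα : γ ≤ α) {z : ℂ} (hG : ‖endpointG a b f z‖ ≤ C * ‖endpointQ a b z‖ ^ α)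
    (hB : ‖f b - f a‖ ≤ B) (hAa : ‖z - a‖ ≤ A) (hAb : ‖z - b‖ ≤ A) :
    ‖f z - f a‖ ≤ (C * (A ^ (α - γ) * A ^ α) + A ^ (1 - γ) * B / (b - a)) * ‖z - a‖ ^ γ ∧
    ‖f z - f b‖ ≤ (C * (A ^ (α - γ) * A ^ α) + A ^ (1 - γ) * B / (b - a)) * ‖z - b‖ ^ γ := by
  have hA : 0 ≤ A := (norm_nonneg _).trans hAa
  have hα : 0 < α := hγ0.trans_le hγα
  rw [norm_endpointQ_rpow, norm_sub_rev (b : ℂ)] at hG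
  constructor
  · rw [sub_left_eq_endpointG hab, add_mul]
    refine (norm_add_le _ _).trans (add_le_add (hG.trans ?_)
      (norm_div_sub_mul_le hab hAa hB hγ0 hγ1))
    have h1 := rpow_le_mul_rpow (norm_nonneg _) hAa hγ0 hγα
    calc C * (‖z - a‖ ^ α * ‖z - b‖ ^ α) ≤ C * (A ^ (α - γ) * ‖z - a‖ ^ γ * A ^ α) := by gcongr
      _ = _ := by ring
  · rw [sub_right_eq_endpointG hab, add_mul, norm_sub_rev z (b : ℂ)]
    rw [norm_sub_rev] at hAb hB
    refine (norm_add_le _ _).trans (add_le_add (hG.trans ?_)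
      (norm_div_sub_mul_le hab hAb hB hγ0 hγ1))
    rw [norm_sub_rev z (b : ℂ)]
    have h1 := rpow_le_mul_rpow (norm_nonneg _) hAb hγ0 hγα
    calc C * (‖z - a‖ ^ α * ‖(b : ℂ) - z‖ ^ α)
        ≤ C * (A ^ α * (A ^ (α - γ) * ‖(b : ℂ) - z‖ ^ γ)) := by gcongr
      _ = _ := by ring

/-- Conversely, Hölder estimates near `a` and `b` put `endpointG a b f` into the class `L`. -/
theorem memL_endpointG (hab : a < b) {γ A C : ℝ} (hγ0 : 0 < γ) (hγ1 : γ ≤ 1)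
    (hf : MemHInf D f) (hA : ∀ z ∈ D, ‖z - a‖ ≤ A ∧ ‖z - b‖ ≤ A)
    (hfa : ∀ z ∈ D, 2 * ‖z - a‖ < b - a → ‖f z - f a‖ ≤ C * ‖z - a‖ ^ γ)
    (hfb : ∀ z ∈ D, 2 * ‖z - b‖ < b - a → ‖f z - f b‖ ≤ C * ‖z - b‖ ^ γ) :
    MemL a b γ D (endpointG a b f) := by
  have hba := sub_pos.2 hab
  obtain ⟨Cf, hCf⟩ := hf.2
  have hbound : ∀ z ∈ D, ‖endpointG a b f z‖ ≤
      Cf + (A / (b - a) * ‖f a‖ + A / (b - a) * ‖f b‖) := by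
    intro z hz
    rw [endpointG]
    refine (norm_sub_le _ _).trans (add_le_add (hCf z hz) ((norm_add_le _ _).trans
      (add_le_add ?_ ?_)))
    · rw [norm_mul, norm_div, ← Complex.ofReal_sub b a, Complex.norm_real,
        Real.norm_of_nonneg hba.le, norm_sub_rev]
      have := (hA z hz).2
      gcongr
    · rw [norm_mul, norm_div, ← Complex.ofReal_sub b a, Complex.norm_real,
        Real.norm_of_nonneg hba.le]
      have := (hA z hz).1
      gcongr
  refine ⟨⟨?_, _, hbound⟩, ?_⟩
  · unfold endpointG
    exact hf.1.sub (by fun_prop)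
  set E := Cf + (A / (b - a) * ‖f a‖ + A / (b - a) * ‖f b‖)
  set r := (b - a) / 2 with hr
  have hr0 : 0 < r := half_pos hba
  set S := |C| + r ^ (1 - γ) * ‖f b - f a‖ / (b - a) with hS
  have hS0 : 0 ≤ S := by positivity
  have hrγ : 0 < r ^ γ := Real.rpow_pos_of_pos hr0 _
  refine ⟨S / r ^ γ + |E| / (r ^ γ * r ^ γ) + 1, by positivity, fun z hz => ?_⟩
  have hsum : b - a ≤ ‖z - a‖ + ‖(b : ℂ) - z‖ := by
    have := norm_add_le (z - a) ((b : ℂ) - z)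
    rwa [show z - a + ((b : ℂ) - z) = ((b - a : ℝ) : ℂ) by push_cast; ring, Complex.norm_real,
      Real.norm_of_nonneg hba.le] at this
  rw [norm_endpointQ_rpow]
  -- it suffices to dominate by one of the two summands of the constant
  have hfin : ∀ c ≤ S / r ^ γ + |E| / (r ^ γ * r ^ γ),
      ‖endpointG a b f z‖ ≤ c * (‖z - a‖ ^ γ * ‖(b : ℂ) - z‖ ^ γ) →
      ‖endpointG a b f z‖ ≤ (S / r ^ γ + |E| / (r ^ γ * r ^ γ) + 1) *
        (‖z - a‖ ^ γ * ‖(b : ℂ) - z‖ ^ γ) := fun c hc h => h.trans (by gcongr; linarith)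
  have hc1 : S / r ^ γ ≤ S / r ^ γ + |E| / (r ^ γ * r ^ γ) := le_add_of_nonneg_right (by positivity)
  have hc2 : |E| / (r ^ γ * r ^ γ) ≤ S / r ^ γ + |E| / (r ^ γ * r ^ γ) :=
    le_add_of_nonneg_left (by positivity)
  by_cases h1 : ‖z - a‖ < r
  · refine hfin _ hc1 ?_
    have h2 := hfa z hz (by linarith)
    have h3 := norm_div_sub_mul_le hab h1.le (le_refl ‖f b - f a‖) hγ0 hγ1
    have h4 : ‖endpointG a b f z‖ ≤ S * ‖z - a‖ ^ γ := by
      rw [show endpointG a b f z = (f z - f a) - (z - a) / (b - a) * (f b - f a) by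
        rw [sub_left_eq_endpointG hab f z]; ring, hS, add_mul]
      refine (norm_sub_le _ _).trans (add_le_add (h2.trans ?_) h3)
      gcongr
      exact le_abs_self C
    have h5 : r ^ γ ≤ ‖(b : ℂ) - z‖ ^ γ := by
      gcongr
      linarith
    calc ‖endpointG a b f z‖ ≤ S * ‖z - a‖ ^ γ := h4
      _ = S / r ^ γ * (‖z - a‖ ^ γ * r ^ γ) := by field_simp
      _ ≤ _ := by gcongr
  by_cases h1' : ‖(b : ℂ) - z‖ < r
  · refine hfin _ hc1 ?_
    have h2 := hfb z hz (by rw [norm_sub_rev]; linarith)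
    have h3 := norm_div_sub_mul_le hab h1'.le (norm_sub_rev (f a) (f b)).le hγ0 hγ1
    have h4 : ‖endpointG a b f z‖ ≤ S * ‖(b : ℂ) - z‖ ^ γ := by
      rw [show endpointG a b f z = (f z - f b) - (b - z) / (b - a) * (f a - f b) by
        rw [sub_right_eq_endpointG hab f z]; ring, hS, add_mul]
      refine (norm_sub_le _ _).trans (add_le_add (h2.trans ?_) h3)
      rw [norm_sub_rev z]
      gcongr
      exact le_abs_self C
    have h5 : r ^ γ ≤ ‖z - a‖ ^ γ := by
      gcongr
      linarith
    calc ‖endpointG a b f z‖ ≤ S * ‖(b : ℂ) - z‖ ^ γ := h4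
      _ = S / r ^ γ * (r ^ γ * ‖(b : ℂ) - z‖ ^ γ) := by field_simp
      _ ≤ _ := by gcongr
  · refine hfin _ hc2 ?_
    calc ‖endpointG a b f z‖ ≤ |E| := (hbound z hz).trans (le_abs_self _)
      _ = |E| / (r ^ γ * r ^ γ) * (r ^ γ * r ^ γ) := by field_simp
      _ ≤ _ := by
        gcongr
        · exact not_lt.1 h1
        · exact not_lt.1 h1'

end EndpointClasses

/-! ### The Urysohn equation -/

theorem starAboutInterval_lens {a b d : ℝ} (hd0 : 0 < d) (hdπ : d < Real.pi) :
    StarAboutInterval a b {z | 0 < lensFun a b d z} where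
  isOpen := isOpen_lens a b d
  ofReal_mem _ hx := ofReal_mem_lens hd0 hdπ hx
  segment_mem _ hz _ hp _ h0 h1 := lensFun_segment_pos hd0 hdπ hz hp h0 h1

/-- The identity theorem from the interval `(a, b)` to a domain containing it. -/
theorem eqOn_of_eqOn_Ioo {a b : ℝ} (hab : a < b) {D : Set ℂ} (hD : IsOpen D)
    (hconn : IsPreconnected D) (hIoo : ∀ x ∈ Ioo a b, (x : ℂ) ∈ D) {f g : ℂ → ℂ}
    (hf : DifferentiableOn ℂ f D) (hg : DifferentiableOn ℂ g D)
    (hfg : ∀ x ∈ Ioo a b, f (x : ℝ) = g (x : ℝ)) : EqOn f g D := by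
  have hc : (a + b) / 2 ∈ Ioo a b := ⟨by linarith, by linarith⟩
  refine (hf.analyticOnNhd hD).eqOn_of_preconnected_of_frequently_eq (hg.analyticOnNhd hD) hconn
    (hIoo _ hc) ?_
  have h1 : Tendsto (fun x : ℝ => (x : ℂ)) (𝓝[≠] ((a + b) / 2)) (𝓝[≠] (((a + b) / 2 : ℝ) : ℂ)) :=
    Complex.continuous_ofReal.continuousWithinAt.tendsto_nhdsWithin fun x hx => by
      simpa only [mem_compl_iff, mem_singleton_iff, Complex.ofReal_inj] using hx
  refine h1.frequently (Eventually.frequently ?_)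
  filter_upwards [mem_nhdsWithin_of_mem_nhds (Ioo_mem_nhds hc.1 hc.2)] with x hx using hfg x hx

theorem theorem3 (a b d lam β : ℝ) (hab : a < b) (hd0 : 0 < d) (hdπ : d < Real.pi)
    (hlam0 : 0 < lam) (hlam1 : lam < 1) (hβ0 : 0 < β)
    (D : Set ℂ) (hD : D = seDomain a b d)
    (k : ℂ → ℂ → ℂ → ℂ) (g u : ℂ → ℂ)
    (hk_snd : ∀ z ∈ closure D, ∀ w ∈ closure D, MemHInf D (fun v => k z v w))
    (hk_trd : ∀ z ∈ closure D, ∀ v ∈ closure D, MemHInf D (fun w => k z v w))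
    (hk_fst : UniformlyMemM a b (1 - lam) D
      (fun (p : closure D × closure D) (z : ℂ) => k z p.1 p.2))
    (hk_bdd : ∃ M : ℝ, ∀ z ∈ closure D, ∀ v ∈ closure D, ∀ w ∈ closure D, ‖k z v w‖ ≤ M)
    (hg : MemM a b β D g)
    (hu : IsUrysohnSolution a b lam D k g u) :
    MemM a b (min (1 - lam) β) D u := by
  rw [seDomain_eq hab hd0 hdπ] at hD
  obtain ⟨⟨huD, hucont⟩, humaps, hueq⟩ := hu
  have hl := sub_pos.2 hlam1
  have hstar : StarAboutInterval a b D := hD ▸ starAboutInterval_lens hd0 hdπ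
  have hconn : IsPreconnected D := hD ▸ isPreconnected_lens hab hd0 hdπ
  have hreg : interior (closure D) ⊆ D := hD ▸ interior_closure_lens_subset hd0 hdπ
  have hrefl : ∀ z ∈ D, (a : ℂ) + b - z ∈ D := by
    subst hD
    intro z hz
    rwa [mem_ofPred_eq, lensFun_reflect]
  have hslitb : ∀ z ∈ D, (b : ℂ) - z ∈ Complex.slitPlane := by
    subst hD
    exact fun z hz => sub_mem_slitPlane_of_lens hab hd0 hdπ hz
  have hslita : ∀ z ∈ D, z - a ∈ Complex.slitPlane := fun z hz => by
    rw [show z - a = (b : ℂ) - (a + b - z) by ring]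
    exact hslitb _ (hrefl z hz)
  have hIcc : ∀ x ∈ Icc a b, (x : ℂ) ∈ closure D := by
    subst hD
    exact fun x hx => closure_lens_of_mem_Icc hab hd0 hdπ hx
  have haI : a ∈ Icc a b := ⟨le_rfl, hab.le⟩
  have hbI : b ∈ Icc a b := ⟨hab.le, le_rfl⟩
  have haD : (a : ℂ) ∉ D := fun h => Complex.slitPlane_ne_zero (hslita _ h) (sub_self _)
  have hbD : (b : ℂ) ∉ D := fun h => Complex.slitPlane_ne_zero (hslitb _ h) (sub_self _)
  obtain ⟨A, hA⟩ : ∃ A : ℝ, ∀ z ∈ D, ‖z - a‖ ≤ A ∧ ‖z - b‖ ≤ A := by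
    obtain ⟨R, hR⟩ := exists_norm_le_of_lens a b hd0 hdπ
    subst hD
    refine ⟨R + |a| + |b|, fun z hz => ⟨(norm_sub_le _ _).trans ?_, (norm_sub_le _ _).trans ?_⟩⟩
    · rw [Complex.norm_real, Real.norm_eq_abs]; linarith [hR z hz, abs_nonneg b]
    · rw [Complex.norm_real, Real.norm_eq_abs]; linarith [hR z hz, abs_nonneg a]
  have hγ0 : 0 < min (1 - lam) β := lt_min hl hβ0
  have hγ1 : min (1 - lam) β ≤ 1 := (min_le_left _ _).trans (by linarith)
  refine ⟨huD.1, hucont, ?_⟩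
  rcases eqOn_const_or_mapsTo_of_mapsTo_closure hstar.isOpen hconn hreg huD.1
    (fun z hz => humaps (subset_closure hz)) with ⟨w, hw⟩ | huDD
  · -- a constant `u` has constant values at `a` and `b` too
    have hwc : EqOn u (fun _ => w) (closure D) :=
      EqOn.of_subset_closure hw hucont continuousOn_const subset_closure subset_rfl
    refine memL_endpointG (C := 0) hab hγ0 hγ1 huD hA (fun z hz _ => ?_) fun z hz _ => ?_
    · rw [hw z hz, hwc (hIcc a haI), sub_self, norm_zero, zero_mul]
    · rw [hw z hz, hwc (hIcc b hbI), sub_self, norm_zero, zero_mul]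
  obtain ⟨M, hM⟩ := hk_bdd
  obtain ⟨hkM, C, hC0, hC⟩ := hk_fst
  set K : ℂ → ℂ → ℂ := fun z s => k z s (u s)
  have hKM : ∀ z ∈ closure D, ∀ s ∈ D, ‖K z s‖ ≤ M := fun z hz s hs =>
    hM z hz s (subset_closure hs) _ (humaps (subset_closure hs))
  have hK2 : ∀ z ∈ closure D, DifferentiableOn ℂ (K z) D := fun z hz =>
    differentiableOn_diagonal hstar.isOpen (f := fun v s => k z v (u s))
      (fun v hv s hs => hM z hz v (subset_closure hv) _ (humaps (subset_closure hs)))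
      (fun s hs => (hk_snd z hz _ (humaps (subset_closure hs))).1)
      (fun v hv => (hk_trd z hz v (subset_closure hv)).1.comp huD.1 huDD)
  have hK1 : ∀ s ∈ D, DifferentiableOn ℂ (fun z => K z s) D := fun s hs =>
    (hkM (⟨s, subset_closure hs⟩, ⟨u s, humaps (subset_closure hs)⟩)).1
  have hKab : ∀ s ∈ D, ‖K b s - K a s‖ ≤ 2 * M := fun s hs => by
    refine (norm_sub_le _ _).trans ?_
    linarith [hKM a (hIcc a haI) s hs, hKM b (hIcc b hbI) s hs]
  have hKL : ∀ z ∈ D, ∀ s ∈ D, _ := fun z hz s hs =>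
    norm_sub_endpoint_le (f := fun z => K z s) hab hC0.le hl (by linarith) le_rfl
      (hC (⟨s, subset_closure hs⟩, ⟨u s, humaps (subset_closure hs)⟩) z hz) (hKab s hs)
      (hA z hz).1 (hA z hz).2
  -- the extended equation holds on `D` by the identity theorem
  have hext : EqOn (fun z => u z - g z) (singularExt lam a b K) D := by
    refine eqOn_of_eqOn_Ioo hab hstar.isOpen hconn hstar.ofReal_mem (huD.1.sub hg.1)
      (differentiableOn_singularExt hlam1 hab.le hstar hslitb hslita
        (fun z hz => hKM z (subset_closure hz)) hK1 fun z hz => hK2 z (subset_closure hz)) ?_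
    intro t ht
    have htc := hIcc t (Ioo_subset_Icc_self ht)
    rw [singularExt_ofReal hlam1 hstar ht (hKM t htc) (hK2 t htc).continuousOn,
      hueq t (Ioo_subset_Icc_self ht), add_sub_cancel_left]
  have hinsa : ∀ z ∈ insert (a : ℂ) D, z ∈ closure D := by
    rintro z (rfl | hz)
    exacts [hIcc a haI, subset_closure hz]
  have hinsb : ∀ z ∈ insert (b : ℂ) D, z ∈ closure D := by
    rintro z (rfl | hz)
    exacts [hIcc b hbI, subset_closure hz]
  obtain ⟨Ca, hCa⟩ := exists_norm_singularExt_sub_left_le hlam0 hlam1 hab hstar haD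
    (fun z hz => hKM z (hinsa z hz)) (fun z hz => hK2 z (hinsa z hz))
    fun z hz s hs => (hKL z hz s hs).1
  obtain ⟨Cb, hCb⟩ := exists_norm_singularExt_sub_right_le hlam0 hlam1 hab hstar hrefl hbD
    (fun z hz => hKM z (hinsb z hz)) (fun z hz => hK2 z (hinsb z hz))
    fun z hz s hs => (hKL z hz s hs).2
  obtain ⟨Cg, hCg0, hCg⟩ := hg.2.2.2
  have hgL : ∀ z ∈ D, _ := fun z hz =>
    norm_sub_endpoint_le hab hCg0.le hγ0 hγ1 (min_le_right _ _) (hCg z hz)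
      (le_refl ‖g b - g a‖) (hA z hz).1 (hA z hz).2
  -- both exponents are lowered to their minimum
  have hcomb : ∀ (e : ℂ) (c Cg : ℝ), (e = a ∨ e = b) → ∀ z ∈ D,
      ‖g z - g e‖ ≤ Cg * ‖z - e‖ ^ (min (1 - lam) β) →
      ‖(u z - g z) - (u e - g e)‖ ≤ c * ‖z - e‖ ^ (1 - lam) →
      ‖u z - u e‖ ≤ (|c| * A ^ (1 - lam - min (1 - lam) β) + |Cg|) *
        ‖z - e‖ ^ (min (1 - lam) β) := by
    intro e c Cg he z hz h1 h2
    have hAe : ‖z - e‖ ≤ A := by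
      rcases he with rfl | rfl
      exacts [(hA z hz).1, (hA z hz).2]
    have h3 := rpow_le_mul_rpow (norm_nonneg (z - e)) hAe hγ0 (min_le_left (1 - lam) β)
    rw [show u z - u e = ((u z - g z) - (u e - g e)) + (g z - g e) by ring, add_mul]
    refine (norm_add_le _ _).trans (add_le_add (h2.trans ?_) (h1.trans ?_))
    · rw [mul_assoc]
      calc c * ‖z - e‖ ^ (1 - lam) ≤ |c| * ‖z - e‖ ^ (1 - lam) := by
            gcongr; exact le_abs_self c
        _ ≤ _ := by gcongr
    · gcongr
      exact le_abs_self Cg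
  have hfin : ∀ e : ℝ, e ∈ Icc a b → (∫ s in a..b, ((|e - s| ^ (-lam) : ℝ) : ℂ) * K e s) =
      u e - g e := fun e he => by rw [hueq e he, add_sub_cancel_left]
  obtain ⟨Ea, hEa⟩ : ∃ E : ℝ, ∀ z ∈ D, 2 * ‖z - a‖ < b - a →
      ‖u z - u a‖ ≤ E * ‖z - a‖ ^ (min (1 - lam) β) := by
    refine ⟨_, fun z hz hza => hcomb a Ca _ (Or.inl rfl) z hz (hgL z hz).1 ?_⟩
    rw [← hfin a haI, show u z - g z = singularExt lam a b K z from hext hz]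
    exact hCa z hz hza
  obtain ⟨Eb, hEb⟩ : ∃ E : ℝ, ∀ z ∈ D, 2 * ‖z - b‖ < b - a →
      ‖u z - u b‖ ≤ E * ‖z - b‖ ^ (min (1 - lam) β) := by
    refine ⟨_, fun z hz hzb => hcomb b Cb _ (Or.inr rfl) z hz (hgL z hz).2 ?_⟩
    rw [← hfin b hbI, show u z - g z = singularExt lam a b K z from hext hz]
    exact hCb z hz hzb
  refine memL_endpointG (C := max Ea Eb) hab hγ0 hγ1 huD hA
    (fun z hz hza => (hEa z hz hza).trans ?_) fun z hz hzb => (hEb z hz hzb).trans ?_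
  · gcongr
    exact le_max_left _ _
  · gcongr
    exact le_max_right _ _
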